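/- Let $n\ge 2$ and let $(M,g,J)$ be a connected Kähler manifold of real dimension $2n$: $M$ is a smooth manifold, $g$ is a Riemannian metric with Levi-Civita connection $\nabla$, and $J$ is an almost complex structure with $g(Ju,Jv)=g(u,v)$ and $\nabla J=0$. Let $J_{ab}$ be the Kähler form, $J_{ab}u^av^b=g(Ju,v)$, and let $J^{ab}$ be its inverse, $J_{ab}J^{ac}=\delta_b{}^c$. Let $R_{ab}{}^c{}_d$ be the curvature of $\nabla$, $(\nabla_a\nabla_b-\nabla_b\nabla_a)X^c=R_{ab}{}^c{}_dX^d$, and put $$\Phi_{bd}=\frac1{2(n+1)}R_{ab}{}^a{}_d,\qquad S_a=\frac1{2n+1}J^{bc}\nabla_c\Phi_{ab}.$$ The symplectic tractor connection is the connection on the vector bundle $\mathcal T=\Lambda^0\oplus\Lambda^1\oplus\Lambda^0$ given by $$\nabla_a\begin{bmatrix}\sigma\\ \mu_b\\ \rho\end{bmatrix}=\begin{bmatrix}\nabla_a\sigma-\mu_a\\ \nabla_a\mu_b+J_{ab}\rho+\Phi_{ab}\sigma\\ \nabla_a\rho-\Phi_{ab}J^{bc}\mu_c+S_a\sigma\end{bmatrix}.$$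 This connection is symplectically flat, meaning that there is an endomorphism $\Theta$ of $\mathcal T$ with $(\nabla_a\nabla_b-\nabla_b\nabla_a)\Sigma=2J_{ab}\Theta\Sigma$ for all smooth sections $\Sigma$ of $\mathcal T$ (where $\nabla_a\nabla_b-\nabla_b\nabla_a$ denotes the curvature of the tractor connection), if and only if $g$ has constant holomorphic sectional curvature, meaning that there is a real number $c$ such that, for every point $x\in M$ and every nonzero $v\in T_xM$, the plane spanned by $v$ and $Jv$ has sectional curvature $c$. -/

import Mathlib

open Bundle Manifold
open scoped ContDiff

noncomputable section

namespace SymplecticTractor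

/-! ### Curvature of a connection and symplectic flatness -/

section General

variable {E : Type*} [NormedAddCommGroup E] [NormedSpace ℝ E]
  {H : Type*} [TopologicalSpace H] {I : ModelWithCorners ℝ E H}
  {M : Type*} [TopologicalSpace M] [ChartedSpace H M] [IsManifold I 1 M]
  {F : Type*} [NormedAddCommGroup F] [NormedSpace ℝ F]
  {V : M → Type*} [TopologicalSpace (TotalSpace F V)]
  [∀ x, AddCommGroup (V x)] [∀ x, Module ℝ (V x)]
  [∀ x : M, TopologicalSpace (V x)]
  [∀ x, IsTopologicalAddGroup (V x)] [∀ x, ContinuousSMul ℝ (V x)]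
  [FiberBundle F V]

/-- The curvature `∇_X ∇_Y σ - ∇_Y ∇_X σ - ∇_[X,Y] σ` of a connection `∇` on a vector bundle,
that is, `X^a Y^b (∇_a ∇_b - ∇_b ∇_a) σ`. In Mathlib, `(∇_X σ) x` is written `∇ σ x (X x)`. -/
def curvature (cov : CovariantDerivative I F V)
    (X Y : Π x : M, TangentSpace I x) (σ : Π x : M, V x) (x : M) : V x :=
  cov (fun y ↦ cov σ y (Y y)) x (X x) - cov (fun y ↦ cov σ y (X y)) x (Y x)
    - cov σ x (VectorField.mlieBracket I X Y x)

/-- A connection `∇` on a vector bundle `V` is symplectically flat with respect to the 2-form `Ω`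
if there is a bundle endomorphism `Θ` of `V` with
`(∇_a ∇_b - ∇_b ∇_a) σ = 2 Ω_ab Θ σ` for every smooth section `σ`. -/
def IsSymplecticallyFlat (Ω : Π x : M, TangentSpace I x →L[ℝ] TangentSpace I x →L[ℝ] ℝ)
    (cov : CovariantDerivative I F V) : Prop :=
  ∃ Θ : Π x : M, V x →ₗ[ℝ] V x,
    ∀ X Y : Π x : M, TangentSpace I x,
      ContMDiff I (I.prod 𝓘(ℝ, E)) ∞ (fun x ↦ (⟨x, X x⟩ : TotalSpace E (TangentSpace I))) →
      ContMDiff I (I.prod 𝓘(ℝ, E)) ∞ (fun x ↦ (⟨x, Y x⟩ : TotalSpace E (TangentSpace I))) →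
      ∀ σ : Π x : M, V x,
        ContMDiff I (I.prod 𝓘(ℝ, F)) ∞ (fun x ↦ (⟨x, σ x⟩ : TotalSpace F V)) →
        ∀ x : M, curvature cov X Y σ x = (2 * Ω x (X x) (Y x)) • Θ x (σ x)

end General

/-! ### Tensor calculus for a connection on the tangent bundle -/

section Tensors

variable {E : Type*} [NormedAddCommGroup E] [NormedSpace ℝ E] [FiniteDimensional ℝ E]
  {H : Type*} [TopologicalSpace H] {I : ModelWithCorners ℝ E H}
  {M : Type*} [TopologicalSpace M] [ChartedSpace H M] [IsManifold I 1 M]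

variable (I) in
/-- A basis `e_i` of the tangent space at `x`, used for writing tensors in components. -/
def basisAt (x : M) :
    Module.Basis (Fin (Module.finrank ℝ E)) ℝ (TangentSpace I x) :=
  Module.finBasis ℝ E

variable (I) in
/-- The dual basis `e^i` of the cotangent space at `x`. -/
def dualBasisAt (x : M) (i : Fin (Module.finrank ℝ E)) :
    TangentSpace I x →L[ℝ] ℝ :=
  (Module.Basis.coord (Module.finBasis ℝ E) i).toContinuousLinearMap

variable (I) in
/-- The frame field `e_i` near `x`: the vector field that is constant in the preferred
trivialization of the tangent bundle at `x` and whose value at `x` is the basis vector `e_i`. -/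
def frameAt (x : M) (i : Fin (Module.finrank ℝ E)) :
    Π y : M, TangentSpace I y :=
  FiberBundle.extend E (basisAt I x i)

/-- The curvature tensor `R(u, v) w = u^a v^b R_ab^c_d w^d` of a connection on the tangent bundle,
computed by extending `u`, `v`, `w` to vector fields that are smooth near `x`. -/
def curvatureTensor (cov : CovariantDerivative I E (TangentSpace I : M → Type _)) (x : M)
    (u v w : TangentSpace I x) : TangentSpace I x :=
  curvature cov (FiberBundle.extend E u) (FiberBundle.extend E v) (FiberBundle.extend E w) x

/-- The Ricci tensor `R_bd = R_ab^a_d`, the trace of `u ↦ R(u, v) w`, as the bilinear form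
with the components `R_ij = ∑ k, e^k (R(e_k, e_i) e_j)`. -/
def ricci (cov : CovariantDerivative I E (TangentSpace I : M → Type _)) (x : M) :
    TangentSpace I x →L[ℝ] TangentSpace I x →L[ℝ] ℝ :=
  ∑ i, ∑ j, (∑ k, dualBasisAt I x k
      (curvatureTensor cov x (basisAt I x k) (basisAt I x i) (basisAt I x j))) •
    (dualBasisAt I x i).smulRight (dualBasisAt I x j)

/-- `Φ_bd = R_ab^a_d / (2 (n + 1))`, where `2 n` is the dimension of the manifold. -/
def Phi (cov : CovariantDerivative I E (TangentSpace I : M → Type _)) (x : M) :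
    TangentSpace I x →L[ℝ] TangentSpace I x →L[ℝ] ℝ :=
  ((Module.finrank ℝ E : ℝ) + 2)⁻¹ • ricci cov x

/-- The induced connection on 1-forms: `(∇ μ)(u, e_i) = u (μ(e_i)) - μ(∇_u e_i)`.
The value `nablaOneForm cov μ x u` is `∇_u μ` at `x`. -/
def nablaOneForm (cov : CovariantDerivative I E (TangentSpace I : M → Type _))
    (μ : Π x : M, TangentSpace I x →L[ℝ] ℝ) (x : M) :
    TangentSpace I x →L[ℝ] TangentSpace I x →L[ℝ] ℝ :=
  ∑ i, (mvfderiv I (fun y ↦ μ y (frameAt I x i y)) x - (μ x).comp (cov (frameAt I x i) x)).smulRight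
    (dualBasisAt I x i)

/-- The components `(∇_u B)(e_i, e_j) = u (B(e_i, e_j)) - B(∇_u e_i, e_j) - B(e_i, ∇_u e_j)` of
the covariant derivative of a covariant 2-tensor `B`. -/
def nablaTwoTensor (cov : CovariantDerivative I E (TangentSpace I : M → Type _))
    (B : Π x : M, TangentSpace I x →L[ℝ] TangentSpace I x →L[ℝ] ℝ) (x : M)
    (u : TangentSpace I x) (i j : Fin (Module.finrank ℝ E)) : ℝ :=
  mvfderiv I (fun y ↦ B y (frameAt I x i y) (frameAt I x j y)) x u
    - B x (cov (frameAt I x i) x u) (frameAt I x j x)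
    - B x (frameAt I x i x) (cov (frameAt I x j) x u)

/-- Raising an index: `(μ♯)^b = Ω^bc μ_c`, where `Ω_ab Ω^ac = δ_b^c`. Equivalently, `μ♯` is the
vector with `Ω(μ♯, v) = μ(v)` for all `v` (for nondegenerate `Ω`). -/
def sharp (Ω : Π x : M, TangentSpace I x →L[ℝ] TangentSpace I x →L[ℝ] ℝ) (x : M) :
    (TangentSpace I x →L[ℝ] ℝ) →L[ℝ] TangentSpace I x :=
  (Ω x).inverse

/-- The 1-form `S_a = (1 / (2 n + 1)) Ω^bc ∇_c Φ_ab`. With `Φ_ij = Φ(e_i, e_j)` and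
`Ω^jk = e^j((e^k)♯)`, its components are
`S_i = (1 / (2 n + 1)) ∑ j k, Ω^jk (∇_{e_k} Φ)(e_i, e_j)`. -/
def S (cov : CovariantDerivative I E (TangentSpace I : M → Type _))
    (Ω : Π x : M, TangentSpace I x →L[ℝ] TangentSpace I x →L[ℝ] ℝ) (x : M) :
    TangentSpace I x →L[ℝ] ℝ :=
  ((Module.finrank ℝ E : ℝ) + 1)⁻¹ • ∑ i, (∑ j, ∑ k,
    dualBasisAt I x j (sharp Ω x (dualBasisAt I x k)) *
      nablaTwoTensor cov (Phi cov) x (basisAt I x k) i j) • dualBasisAt I x i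

/-! ### The symplectic tractor bundle and its connection -/

variable (I M) in
/-- The standard tractor bundle `Λ⁰ ⊕ Λ¹ ⊕ Λ⁰`: its elements over `x` are triples `(σ, μ, ρ)`
of a number, a covector at `x` and a number. -/
abbrev TractorBundle : M → Type _ :=
  (Bundle.Trivial M ℝ) ×ᵇ
    ((fun x : M ↦ TangentSpace I x →L[ℝ] Bundle.Trivial M ℝ x) ×ᵇ (Bundle.Trivial M ℝ))

/-- The model fibre of the standard tractor bundle, of dimension `2 n + 2`. -/
abbrev TractorFiber (E : Type*) [NormedAddCommGroup E] [NormedSpace ℝ E] : Type _ :=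
  ℝ × (E →L[ℝ] ℝ) × ℝ

/-- Evaluation of covectors at a tangent vector. -/
def evalAt {x : M} (v : TangentSpace I x) : (TangentSpace I x →L[ℝ] ℝ) →L[ℝ] ℝ where
  toFun φ := φ v
  map_add' _ _ := rfl
  map_smul' _ _ := rfl
  cont := continuous_eval_const v

/-- The tractor connection as an operator on sections `Σ = (σ, μ, ρ)`:
`∇_a (σ, μ_b, ρ) =
  (∇_a σ - μ_a, ∇_a μ_b + Ω_ab ρ + Φ_ab σ, ∇_a ρ - Φ_ab Ω^bc μ_c + S_a σ)`. -/
def tractorNabla (cov : CovariantDerivative I E (TangentSpace I : M → Type _))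
    (Ω : Π x : M, TangentSpace I x →L[ℝ] TangentSpace I x →L[ℝ] ℝ)
    (s : Π x : M, TractorBundle I M x) (x : M) :
    TangentSpace I x →L[ℝ] TractorBundle I M x :=
  (mvfderiv I (fun y ↦ (s y).1) x - (s x).2.1).prod
    ((nablaOneForm cov (fun y ↦ (s y).2.1) x + (s x).2.2 • Ω x + (s x).1 • Phi cov x).prod
      (mvfderiv I (fun y ↦ (s y).2.2) x - (evalAt (sharp Ω x (s x).2.1)).comp (Phi cov x)
        + (s x).1 • S cov Ω x))

/-- The components of a differentiable section of the tractor bundle are differentiable. -/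
theorem mdiff_comps {s : Π x : M, TractorBundle I M x} {x : M}
    (hs : MDifferentiableAt I (I.prod 𝓘(ℝ, TractorFiber E))
      (fun y ↦ (⟨y, s y⟩ : TotalSpace (TractorFiber E) (TractorBundle I M))) x) :
    MDifferentiableAt I 𝓘(ℝ, ℝ) (fun y ↦ (s y).1) x ∧
    (∀ i, MDifferentiableAt I 𝓘(ℝ, ℝ) (fun y ↦ (s y).2.1 (frameAt I x i y)) x) ∧
    MDifferentiableAt I 𝓘(ℝ, ℝ) (fun y ↦ (s y).2.2) x := by
  rw [mdifferentiableAt_section] at hs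
  refine ⟨?_, fun i ↦ ?_, ?_⟩
  · exact (MDifferentiableAt.comp x ((differentiable_fst (𝕜 := ℝ) (E := ℝ) (F := (E →L[ℝ] ℝ) × ℝ)).differentiableAt.mdifferentiableAt
      (x := (trivializationAt (TractorFiber E) (TractorBundle I M) x ⟨x, s x⟩).2)) hs :)
  · have h1 : MDifferentiableAt I (I.prod 𝓘(ℝ, E →L[ℝ] ℝ)) (fun y ↦ (⟨y, (s y).2.1⟩ :
        TotalSpace (E →L[ℝ] ℝ) (fun x : M ↦ TangentSpace I x →L[ℝ] Bundle.Trivial M ℝ x))) x := by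
      rw [mdifferentiableAt_section]
      exact (MDifferentiableAt.comp x (((differentiable_fst (𝕜 := ℝ) (E := E →L[ℝ] ℝ) (F := ℝ)).comp
      (differentiable_snd (E := ℝ))).differentiableAt.mdifferentiableAt
      (x := (trivializationAt (TractorFiber E) (TractorBundle I M) x ⟨x, s x⟩).2)) hs :)
    have h2 := MDifferentiableAt.clm_bundle_apply (E₂ := Bundle.Trivial M ℝ) (F₂ := ℝ) h1
      (FiberBundle.mdifferentiableAt_extend I E (basisAt I x i))
    exact (mdifferentiableAt_section _ _).1 h2
  · exact (MDifferentiableAt.comp x (((differentiable_snd (𝕜 := ℝ) (E := E →L[ℝ] ℝ) (F := ℝ)).comp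
      (differentiable_snd (E := ℝ))).differentiableAt.mdifferentiableAt
      (x := (trivializationAt (TractorFiber E) (TractorBundle I M) x ⟨x, s x⟩).2)) hs :)

theorem frame_self (x : M) (i) : frameAt I x i x = basisAt I x i := by simp [frameAt]

set_option linter.unusedSectionVars false in
theorem expand (x : M) (φ : TangentSpace I x →L[ℝ] ℝ) :
    ∑ i, φ (basisAt I x i) • dualBasisAt I x i = φ := by
  ext v
  have := (basisAt I x).sum_repr v
  conv_rhs => rw [← this]
  simp only [map_sum, map_smul, sum_apply, smul_apply]
  refine Finset.sum_congr rfl fun i _ ↦ ?_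
  rw [smul_eq_mul, smul_eq_mul, mul_comm]
  rfl

theorem nablaOneForm_add (cov : CovariantDerivative I E (TangentSpace I : M → Type _))
    {μ ν : Π x : M, TangentSpace I x →L[ℝ] ℝ} {x : M}
    (hμ : ∀ i, MDifferentiableAt I 𝓘(ℝ, ℝ) (fun y ↦ μ y (frameAt I x i y)) x)
    (hν : ∀ i, MDifferentiableAt I 𝓘(ℝ, ℝ) (fun y ↦ ν y (frameAt I x i y)) x) :
    nablaOneForm cov (fun y ↦ μ y + ν y) x = nablaOneForm cov μ x + nablaOneForm cov ν x := by
  simp only [nablaOneForm, ← Finset.sum_add_distrib]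
  refine Finset.sum_congr rfl fun i _ ↦ ?_
  ext u v
  simp [mvfderiv_fun_add (hμ i) (hν i)]
  ring

theorem nablaOneForm_smul (cov : CovariantDerivative I E (TangentSpace I : M → Type _))
    {μ : Π x : M, TangentSpace I x →L[ℝ] ℝ} {f : M → ℝ} {x : M}
    (hμ : ∀ i, MDifferentiableAt I 𝓘(ℝ, ℝ) (fun y ↦ μ y (frameAt I x i y)) x)
    (hf : MDifferentiableAt I 𝓘(ℝ, ℝ) f x) :
    nablaOneForm cov (fun y ↦ f y • μ y) x =
      f x • nablaOneForm cov μ x + (mvfderiv I f x).smulRight (μ x) := by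
  conv_rhs => rw [← expand x (μ x)]
  ext u v
  simp only [nablaOneForm, sum_apply, add_apply, smul_apply, ContinuousLinearMap.smulRight_apply, smul_eq_mul, Finset.mul_sum, ← Finset.sum_add_distrib]
  refine Finset.sum_congr rfl fun i _ ↦ ?_
  simp [mvfderiv_fun_mul hf (hμ i), frame_self]
  ring

/-- The symplectic tractor connection, a connection on the standard tractor bundle, associated with
a connection `cov` on the tangent bundle and a 2-form `Ω`. -/
def tractorConnection (cov : CovariantDerivative I E (TangentSpace I : M → Type _))
    (Ω : Π x : M, TangentSpace I x →L[ℝ] TangentSpace I x →L[ℝ] ℝ) :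
    CovariantDerivative I (TractorFiber E) (TractorBundle I M) where
  toFun := tractorNabla cov Ω
  isCovariantDerivativeOnUniv :=
    { add := by
        intro s t x hs ht _
        obtain ⟨h1, h2, h3⟩ := mdiff_comps hs
        obtain ⟨k1, k2, k3⟩ := mdiff_comps ht
        ext u
        · simp [tractorNabla, mvfderiv_fun_add h1 k1]
          ring
        · simp [tractorNabla, nablaOneForm_add cov h2 k2]
          ring
        · simp [tractorNabla, mvfderiv_fun_add h3 k3, evalAt]
          ring
      leibniz := by
        intro s f x hs hf _
        obtain ⟨h1, h2, h3⟩ := mdiff_comps hs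
        change tractorNabla cov Ω (fun y ↦ f y • s y) x = _
        have e1 := mvfderiv_fun_mul hf h1
        have e2 := nablaOneForm_smul cov h2 hf
        have e3 := mvfderiv_fun_mul hf h3
        refine ContinuousLinearMap.ext fun u ↦ Prod.ext ?_ (Prod.ext ?_ ?_)
        · simp [tractorNabla, e1]
          ring
        · simp [tractorNabla, e2]
          module
        · simp [tractorNabla, e3, evalAt]
          ring }
end Tensors

/-! ### Kähler geometry -/

section Kahler

variable {E : Type*} [NormedAddCommGroup E] [NormedSpace ℝ E] [FiniteDimensional ℝ E]
  {H : Type*} [TopologicalSpace H] {I : ModelWithCorners ℝ E H}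
  {M : Type*} [TopologicalSpace M] [ChartedSpace H M] [IsManifold I ∞ M]
  [RiemannianBundle (fun x : M ↦ TangentSpace I x)]
  [IsContMDiffRiemannianBundle I ∞ E (fun x : M ↦ TangentSpace I x)]

/-- `cov` is the Levi-Civita connection of the Riemannian metric: the smooth connection on the
tangent bundle that is torsion-free and preserves the metric,
`u ⟨Y, Z⟩ = ⟨∇_u Y, Z⟩ + ⟨Y, ∇_u Z⟩`. -/
structure IsLeviCivita (cov : CovariantDerivative I E (TangentSpace I : M → Type _)) : Prop where
  smooth : cov.ContMDiffCovariantDerivative ∞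
  torsion_eq_zero : cov.torsion = 0
  metric : ∀ (x : M) (Y Z : Π y : M, TangentSpace I y),
    MDifferentiableAt I (I.prod 𝓘(ℝ, E)) (fun y ↦ (⟨y, Y y⟩ : TotalSpace E (TangentSpace I))) x →
    MDifferentiableAt I (I.prod 𝓘(ℝ, E)) (fun y ↦ (⟨y, Z y⟩ : TotalSpace E (TangentSpace I))) x →
    ∀ u : TangentSpace I x, mvfderiv I (fun y ↦ inner ℝ (Y y) (Z y)) x u =
      inner ℝ (cov Y x u) (Z x) + inner ℝ (Y x) (cov Z x u)

/-- The Riemannian manifold `M` with Levi-Civita connection `cov` and almost complex structure `J`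
is Kähler: `J` is smooth, `J² = -1`, the metric is Hermitian, and `∇ J = 0`. -/
structure IsKahler (cov : CovariantDerivative I E (TangentSpace I : M → Type _))
    (J : Π x : M, TangentSpace I x →L[ℝ] TangentSpace I x) : Prop where
  leviCivita : IsLeviCivita cov
  smooth : ContMDiff I (I.prod 𝓘(ℝ, E →L[ℝ] E)) ∞ (fun x ↦
    (⟨x, J x⟩ : TotalSpace (E →L[ℝ] E) (fun x : M ↦ TangentSpace I x →L[ℝ] TangentSpace I x)))
  sq_eq_neg : ∀ (x : M) (v : TangentSpace I x), J x (J x v) = -v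
  hermitian : ∀ (x : M) (u v : TangentSpace I x), inner ℝ (J x u) (J x v) = inner ℝ u v
  parallel : ∀ (x : M) (Y : Π y : M, TangentSpace I y),
    MDifferentiableAt I (I.prod 𝓘(ℝ, E)) (fun y ↦ (⟨y, Y y⟩ : TotalSpace E (TangentSpace I))) x →
    ∀ u : TangentSpace I x, cov (fun y ↦ J y (Y y)) x u = J x (cov Y x u)

/-- The Kähler form `J_ab`, `Ω(u, v) = g(J u, v)`; thus `J_a^b = J_ac g^bc`. -/
def kahlerForm (J : Π x : M, TangentSpace I x →L[ℝ] TangentSpace I x) (x : M) :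
    TangentSpace I x →L[ℝ] TangentSpace I x →L[ℝ] ℝ :=
  (innerSL ℝ).comp (J x)

/-- The sectional curvature of the plane spanned by `u` and `v`. -/
def sectionalCurvature (cov : CovariantDerivative I E (TangentSpace I : M → Type _)) (x : M)
    (u v : TangentSpace I x) : ℝ :=
  inner ℝ (curvatureTensor cov x u v v) u /
    (inner ℝ u u * inner ℝ v v - inner ℝ u v ^ 2)

/-- The holomorphic sectional curvature, that is, the sectional curvature of the planes spanned by
`v` and `J v`, is one and the same constant for all nonzero tangent vectors `v` of `M`. -/
def HasConstantHolomorphicSectionalCurvature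
    (cov : CovariantDerivative I E (TangentSpace I : M → Type _))
    (J : Π x : M, TangentSpace I x →L[ℝ] TangentSpace I x) : Prop :=
  ∃ c : ℝ, ∀ (x : M) (v : TangentSpace I x), v ≠ 0 → sectionalCurvature cov x v (J x v) = c

end Kahler

end SymplecticTractor

end

/-!
The curvature of the tractor connection is an expression in the curvature `R` of `g`, in `Φ`, in
`S`, and in their derivatives; the two implications read off what they need from it. All tensor
identities are proved as identities between smooth functions, for globally defined smooth vector
fields and 1-forms: smooth germs extend globally by bump functions (`exists_smoothVF_eventuallyEq`),
so a tensor is determined by its values on such fields. That the bracket acts on functions as the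
commutator of derivations (`dir_lie`) is extracted from the Jacobi identity, and with it the usual
symmetries of `R` follow.

Write `Ω(u, v) = g(J u, v)` and let `K(u, v) w` be the curvature tensor of constant holomorphic
sectional curvature `4` (`modelCurv`).

*Flatness implies constant curvature.* On a section `(0, μ, 0)` the 1-form component of the tractor
curvature is tensorial in `μ` and involves only `R` and `Φ` (`curvature_tractor_form`). Taking
`μ = g(w, ·)`, evaluating at the vectors `u`, `w` and pairing with `w`, the term with `R` drops out,
and flatness gives `Φ(u, w) = 0` whenever `u` is orthogonal to `w` and `J w`. As `Φ` is symmetric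
and `n ≥ 2`, this forces `Φ = a g` at each point (`eq_smul_inner_of_orthogonal`). Substituting back,
`R - a K` equals `Ω(u, v)` times an endomorphism, and the first Bianchi identity for `R - a K` makes
that endomorphism vanish, again because `n ≥ 2` (`exists_eq_smul_modelCurv`).
So `R = a K` for a function `a`, which is smooth because it is a quotient of smooth functions.
On the section `(1, 0, 0)` the 1-form component of the tractor curvature contains
`da(X) g(Y, Z) - da(Y) g(X, Z)` (`curvature_tractor_one`); with `Y = Z` orthogonal to `X` and `J X`
all other terms vanish, so `da = 0`, and `a` is constant because `M` is connected.

*Constant curvature implies flatness.* A tensor with the symmetries of a Kähler curvature tensor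
is determined by its holomorphic sectional curvatures (`kahler_polarization`), so `R = a K` with a
constant `a`. Tracing gives `Φ = a g` (`IsKahler.Phi_eq_of_model`), so `S = 0` as `g` is parallel,
and computing the tractor curvature on `(σ, μ, ρ)` yields `2 Ω Θ` with
`Θ (σ, μ, ρ) = (ρ, a μ ∘ J, -a² σ)`.
-/

noncomputable section

set_option linter.unusedSectionVars false

namespace SymplecticTractor

open VectorField Topology

/-! ### Smooth vector fields -/

section Fields

variable {E : Type*} [NormedAddCommGroup E] [NormedSpace ℝ E] [FiniteDimensional ℝ E]
  {M : Type*} [TopologicalSpace M] [ChartedSpace E M] [IsManifold 𝓘(ℝ, E) ∞ M]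

variable (E M) in
/-- Globally defined smooth vector fields on `M`. -/
abbrev SmoothVF : Type _ := Cₛ^∞⟮𝓘(ℝ, E); E, (TangentSpace 𝓘(ℝ, E) : M → Type _)⟯

variable (E M) in
/-- Globally defined smooth functions on `M`. -/
abbrev SmoothFn : Type _ := C^∞⟮𝓘(ℝ, E), M; ℝ⟯

theorem SmoothVF.mdiffAt (X : SmoothVF E M) (x : M) :
    MDifferentiableAt 𝓘(ℝ, E) (𝓘(ℝ, E).prod 𝓘(ℝ, E))
      (fun y ↦ (⟨y, X y⟩ : TotalSpace E (TangentSpace 𝓘(ℝ, E)))) x :=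
  X.mdifferentiableAt

theorem SmoothFn.mdiffAt (f : SmoothFn E M) (x : M) :
    MDifferentiableAt 𝓘(ℝ, E) 𝓘(ℝ, ℝ) f x :=
  f.mdifferentiableAt

/-- The product of a smooth function and a smooth vector field. -/
def fsmul (f : SmoothFn E M) (X : SmoothVF E M) : SmoothVF E M :=
  ⟨fun x ↦ f x • X x, f.contMDiff.smul_section X.contMDiff⟩

/-- The Lie bracket of smooth vector fields. -/
def lie (X Y : SmoothVF E M) : SmoothVF E M :=
  ⟨mlieBracket 𝓘(ℝ, E) X Y, by
    have : IsManifold 𝓘(ℝ, E) ((⊤ : ℕ∞) + 1 : WithTop ℕ∞) M := by simpa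
    have : IsManifold 𝓘(ℝ, E) (minSmoothness ℝ 2) M := by
      rw [minSmoothness_of_isRCLikeNormedField]; infer_instance
    exact ContDiff.mlieBracket_vectorField (n := ⊤) (m := ⊤) X.contMDiff Y.contMDiff (by simp)⟩

/-- The derivative `X f` of a smooth function along a smooth vector field. -/
def dir (X : SmoothVF E M) (f : SmoothFn E M) : SmoothFn E M :=
  ⟨fun x ↦ mvfderiv 𝓘(ℝ, E) f x (X x), by
    have h := f.contMDiff.contMDiff_tangentMap (m := ∞) (by simp)
    exact (contMDiff_snd_tangentBundle_modelSpace ℝ 𝓘(ℝ, ℝ)).comp (h.comp X.contMDiff)⟩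

theorem dir_apply (X : SmoothVF E M) (f : SmoothFn E M) (x : M) :
    dir X f x = mvfderiv 𝓘(ℝ, E) f x (X x) := rfl

theorem dir_add (X : SmoothVF E M) (f g : SmoothFn E M) : dir X (f + g) = dir X f + dir X g := by
  ext x
  simp [dir_apply, mvfderiv_add (f.mdiffAt x) (g.mdiffAt x)]

theorem dir_neg (X : SmoothVF E M) (f : SmoothFn E M) : dir X (-f) = - dir X f := by
  ext x
  simp [dir_apply, mvfderiv_neg]

theorem dir_sub (X : SmoothVF E M) (f g : SmoothFn E M) : dir X (f - g) = dir X f - dir X g := by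
  rw [sub_eq_add_neg, dir_add, dir_neg, sub_eq_add_neg]

theorem dir_mul (X : SmoothVF E M) (f g : SmoothFn E M) :
    dir X (f * g) = f * dir X g + g * dir X f := by
  ext x
  simp [dir_apply, mvfderiv_mul (f.mdiffAt x) (g.mdiffAt x)]

theorem lie_fsmul (f : SmoothFn E M) (X Y : SmoothVF E M) :
    lie X (fsmul f Y) = fsmul (dir X f) Y + fsmul f (lie X Y) := by
  ext x
  exact mlieBracket_smul_right (f.mdiffAt x) (Y.mdiffAt x)

theorem lie_add (X Y Z : SmoothVF E M) : lie X (Y + Z) = lie X Y + lie X Z := by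
  ext x
  exact mlieBracket_add_right (Y.mdiffAt x) (Z.mdiffAt x)

theorem lie_swap (X Y : SmoothVF E M) : lie X Y = - lie Y X := by
  ext x
  exact mlieBracket_swap_apply

theorem jacobi (X Y Z : SmoothVF E M) :
    lie X (lie Y Z) = lie (lie X Y) Z + lie Y (lie X Z) := by
  have e : (minSmoothness ℝ 2 : WithTop ℕ∞) ≤ ∞ := by
    rw [minSmoothness_of_isRCLikeNormedField]; exact (ENat.LEInfty.out : ((2 : ℕ) : WithTop ℕ∞) ≤ ∞)
  have : IsManifold 𝓘(ℝ, E) (minSmoothness ℝ 3) M :=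
    IsManifold.of_le (n := ∞) (by
      rw [minSmoothness_of_isRCLikeNormedField]
      exact (ENat.LEInfty.out : ((3 : ℕ) : WithTop ℕ∞) ≤ ∞))
  ext x
  exact leibniz_identity_mlieBracket_apply ((X.contMDiff x).of_le e) ((Y.contMDiff x).of_le e)
    ((Z.contMDiff x).of_le e)

variable [T2Space M]

/-- Every smooth germ of a vector field extends to a global smooth vector field. -/
theorem exists_smoothVF_eventuallyEq {x : M} (v : TangentSpace 𝓘(ℝ, E) x) :
    ∃ X : SmoothVF E M, ∀ᶠ y in 𝓝 x, X y = FiberBundle.extend E v y := by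
  obtain ⟨s, hs, hsm⟩ := FiberBundle.exists_contMDiffOn_extend (k := ∞) 𝓘(ℝ, E) E v
  obtain ⟨t, hts, hto, hxt⟩ := mem_nhds_iff.1 hs
  obtain ⟨f, -, hf⟩ := ((SmoothBumpFunction.nhds_basis_tsupport (I := 𝓘(ℝ, E)) x).mem_iff).1
    (hto.mem_nhds hxt)
  refine ⟨⟨(f : M → ℝ) • FiberBundle.extend E v,
    ContMDiffOn.smul_section_of_tsupport f.contMDiff.contMDiffOn hto hf (hsm.mono hts)⟩, ?_⟩
  filter_upwards [f.eventuallyEq_one] with y hy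
  simp [hy]

/-- A chosen global smooth vector field through a given tangent vector. It agrees near the base
point with `FiberBundle.extend`. -/
def fieldThrough {x : M} (v : TangentSpace 𝓘(ℝ, E) x) : SmoothVF E M :=
  (exists_smoothVF_eventuallyEq v).choose

theorem fieldThrough_eventuallyEq {x : M} (v : TangentSpace 𝓘(ℝ, E) x) :
    ∀ᶠ y in 𝓝 x, fieldThrough v y = FiberBundle.extend E v y :=
  (exists_smoothVF_eventuallyEq v).choose_spec

@[simp] theorem fieldThrough_self {x : M} (v : TangentSpace 𝓘(ℝ, E) x) :
    fieldThrough v x = v := by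
  simpa using (fieldThrough_eventuallyEq v).self_of_nhds

/-- The Lie bracket acts on functions as the commutator of derivations. This follows from the
Leibniz rule and the Jacobi identity for `X`, `Y` and `f Z` with `Z` nonzero at the point. -/
theorem dir_lie [Nontrivial E] (X Y : SmoothVF E M) (f : SmoothFn E M) :
    dir (lie X Y) f = dir X (dir Y f) - dir Y (dir X f) := by
  ext x
  obtain ⟨e, he⟩ := exists_ne (0 : E)
  let v : TangentSpace 𝓘(ℝ, E) x := e
  let Z := fieldThrough v
  have h := jacobi X Y (fsmul f Z)
  simp only [lie_fsmul, lie_add, jacobi X Y Z] at h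
  have hx := congrArg (fun W : SmoothVF E M ↦ W x) h
  have h0 : (dir X (dir Y f) x - dir Y (dir X f) x - dir (lie X Y) f x) • v = 0 := by
    have hz : Z x = v := fieldThrough_self v
    simp only [fsmul, ContMDiffSection.coe_add, Pi.add_apply, ContMDiffSection.coeFn_mk, hz] at hx
    rw [← sub_eq_zero] at hx
    rw [← hx]
    module
  have := (smul_eq_zero.1 h0).resolve_right he
  change _ = dir X (dir Y f) x - dir Y (dir X f) x
  linarith

end Fields

/-! ### The Levi-Civita connection on smooth vector fields -/

section Fields

variable {E : Type*} [NormedAddCommGroup E] [NormedSpace ℝ E] [FiniteDimensional ℝ E]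
  {M : Type*} [TopologicalSpace M] [ChartedSpace E M] [IsManifold 𝓘(ℝ, E) ∞ M]
  [RiemannianBundle (fun x : M ↦ TangentSpace 𝓘(ℝ, E) x)]
  [IsContMDiffRiemannianBundle 𝓘(ℝ, E) ∞ E (fun x : M ↦ TangentSpace 𝓘(ℝ, E) x)]
  {cov : CovariantDerivative 𝓘(ℝ, E) E (TangentSpace 𝓘(ℝ, E) : M → Type _)}
  {J : Π x : M, TangentSpace 𝓘(ℝ, E) x →L[ℝ] TangentSpace 𝓘(ℝ, E) x}

/-- The smooth function `g(X, Y)`. -/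
def ip (X Y : SmoothVF E M) : SmoothFn E M :=
  ⟨fun x ↦ inner ℝ (X x) (Y x),
    ContMDiff.inner_bundle (IB := 𝓘(ℝ, E)) (F := E) (E := fun x : M ↦ TangentSpace 𝓘(ℝ, E) x)
      (b := fun x ↦ x) X.contMDiff Y.contMDiff⟩

theorem ip_apply (X Y : SmoothVF E M) (x : M) : ip X Y x = inner ℝ (X x) (Y x) := rfl

theorem ip_comm (X Y : SmoothVF E M) : ip X Y = ip Y X := by
  ext x; exact real_inner_comm (Y x) (X x)

theorem ip_add_left (X Y Z : SmoothVF E M) : ip (X + Y) Z = ip X Z + ip Y Z := by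
  ext x; exact inner_add_left (X x) (Y x) (Z x)

theorem ip_sub_left (X Y Z : SmoothVF E M) : ip (X - Y) Z = ip X Z - ip Y Z := by
  ext x; exact inner_sub_left (X x) (Y x) (Z x)

theorem ip_sub_right (X Y Z : SmoothVF E M) : ip X (Y - Z) = ip X Y - ip X Z := by
  ext x; exact inner_sub_right (X x) (Y x) (Z x)

theorem ip_neg_left (X Y : SmoothVF E M) : ip (-X) Y = -ip X Y := by
  ext x; exact inner_neg_left (X x) (Y x)

theorem ip_zero_left (Y : SmoothVF E M) : ip 0 Y = 0 := by
  ext x; exact inner_zero_left (Y x)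

namespace IsLeviCivita

variable (h : IsLeviCivita cov)
include h

/-- The smooth vector field `∇_X Y`. -/
def nabla (X Y : SmoothVF E M) : SmoothVF E M :=
  ⟨fun x ↦ cov Y x (X x), by
    have hY : ContMDiffOn 𝓘(ℝ, E) _ ∞ _ Set.univ :=
      h.smooth.contMDiff.contMDiff (σ := Y) (by simpa using Y.contMDiff.contMDiffOn)
    exact (contMDiffOn_univ.1 hY).clm_bundle_apply X.contMDiff⟩

theorem nabla_apply (X Y : SmoothVF E M) (x : M) : h.nabla X Y x = cov Y x (X x) := rfl

theorem nabla_add (X Y Z : SmoothVF E M) : h.nabla X (Y + Z) = h.nabla X Y + h.nabla X Z := by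
  ext x
  exact congrArg (fun A ↦ A (X x)) (cov.isCovariantDerivativeOnUniv.add (Y.mdiffAt x) (Z.mdiffAt x))

theorem nabla_smul (X Y : SmoothVF E M) (c : ℝ) : h.nabla X (c • Y) = c • h.nabla X Y := by
  ext x
  exact congrArg (fun A ↦ A (X x)) (cov.isCovariantDerivativeOnUniv.smul_const c (Y.mdiffAt x))

theorem nabla_neg (X Y : SmoothVF E M) : h.nabla X (-Y) = -h.nabla X Y := by
  have := h.nabla_smul X Y (-1)
  simpa using this

theorem nabla_sub (X Y Z : SmoothVF E M) : h.nabla X (Y - Z) = h.nabla X Y - h.nabla X Z := by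
  rw [sub_eq_add_neg, nabla_add, nabla_neg, sub_eq_add_neg]

theorem nabla_add_left (X Y Z : SmoothVF E M) : h.nabla (X + Y) Z = h.nabla X Z + h.nabla Y Z := by
  ext x
  simp [nabla_apply]

theorem nabla_neg_left (X Z : SmoothVF E M) : h.nabla (-X) Z = -h.nabla X Z := by
  ext x
  simp [nabla_apply]

theorem nabla_sub_nabla (X Y : SmoothVF E M) : h.nabla X Y - h.nabla Y X = lie X Y := by
  ext x
  exact cov.torsion_eq_zero_iff.1 h.torsion_eq_zero (X.mdiffAt x) (Y.mdiffAt x)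

theorem dir_ip (X Y Z : SmoothVF E M) :
    dir X (ip Y Z) = ip (h.nabla X Y) Z + ip Y (h.nabla X Z) := by
  ext x
  exact h.metric x Y Z (Y.mdiffAt x) (Z.mdiffAt x) (X x)

/-- The smooth vector field `R(X, Y) Z`. -/
def curv (X Y Z : SmoothVF E M) : SmoothVF E M :=
  h.nabla X (h.nabla Y Z) - h.nabla Y (h.nabla X Z) - h.nabla (lie X Y) Z

theorem curv_apply (X Y Z : SmoothVF E M) (x : M) :
    h.curv X Y Z x = curvature cov X Y Z x := rfl

theorem curv_swap (X Y Z : SmoothVF E M) : h.curv X Y Z = -h.curv Y X Z := by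
  rw [curv, curv, lie_swap, nabla_neg_left]
  abel

theorem curv_add (X Y Z W : SmoothVF E M) :
    h.curv X Y (Z + W) = h.curv X Y Z + h.curv X Y W := by
  simp only [curv, nabla_add]
  abel

theorem curv_smul (X Y Z : SmoothVF E M) (c : ℝ) :
    h.curv X Y (c • Z) = c • h.curv X Y Z := by
  simp only [curv, nabla_smul, smul_sub]

theorem curv_add_left (X X' Y Z : SmoothVF E M) :
    h.curv (X + X') Y Z = h.curv X Y Z + h.curv X' Y Z := by
  have : lie (X + X') Y = lie X Y + lie X' Y := by
    rw [lie_swap, lie_add, lie_swap X, lie_swap X']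
    abel
  simp only [curv, nabla_add_left, nabla_add, this]
  abel

/-- The first Bianchi identity: for a torsion-free connection it is the Jacobi identity. -/
theorem bianchi (X Y Z : SmoothVF E M) :
    h.curv X Y Z + h.curv Y Z X + h.curv Z X Y = 0 := by
  have j := jacobi X Y Z
  have e1 : h.nabla X (lie Y Z) - h.nabla (lie Y Z) X = lie X (lie Y Z) := h.nabla_sub_nabla _ _
  have e2 : h.nabla Y (lie Z X) - h.nabla (lie Z X) Y = lie Y (lie Z X) := h.nabla_sub_nabla _ _
  have e3 : h.nabla Z (lie X Y) - h.nabla (lie X Y) Z = lie Z (lie X Y) := h.nabla_sub_nabla _ _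
  have j' : lie X (lie Y Z) + lie Y (lie Z X) + lie Z (lie X Y) = 0 := by
    have : lie Y (lie Z X) = - lie Y (lie X Z) := by
      have e := lie_add Y (lie X Z) (lie Z X)
      have h0 : lie Y (0 : SmoothVF E M) = 0 := by
        simpa using lie_add Y 0 0
      rw [lie_swap X Z, neg_add_cancel, h0, ← lie_swap X Z] at e
      exact (neg_eq_of_add_eq_zero_right e.symm).symm
    rw [j, this, lie_swap Z]
    abel
  rw [← e1, ← e2, ← e3, ← h.nabla_sub_nabla Y Z, ← h.nabla_sub_nabla Z X,
    ← h.nabla_sub_nabla X Y] at j'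
  rw [← j']
  simp only [curv, nabla_sub, ← h.nabla_sub_nabla Y Z, ← h.nabla_sub_nabla Z X,
    ← h.nabla_sub_nabla X Y]
  abel

variable [T2Space M] [Nontrivial E]

/-- `R(X, Y)` is skew for the metric: expand `[X, Y] g(Z, W)` as a commutator. -/
theorem ip_curv (X Y Z W : SmoothVF E M) : ip (h.curv X Y Z) W = -ip Z (h.curv X Y W) := by
  have e := dir_lie X Y (ip Z W)
  simp only [h.dir_ip, dir_add] at e
  simp only [curv, ip_sub_left, ip_sub_right]
  linear_combination -e

/-- The pair symmetry of the curvature, a consequence of the skew symmetries and four instances of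
the first Bianchi identity. -/
theorem ip_curv_pair (X Y Z W : SmoothVF E M) :
    ip (h.curv X Y Z) W = ip (h.curv Z W X) Y := by
  have b (X Y Z W : SmoothVF E M) :
      ip (h.curv X Y Z) W + ip (h.curv Y Z X) W + ip (h.curv Z X Y) W = 0 := by
    rw [← ip_add_left, ← ip_add_left, h.bianchi, ip_zero_left]
  have s (X Y Z W : SmoothVF E M) : ip (h.curv X Y Z) W = - ip (h.curv Y X Z) W := by
    rw [h.curv_swap, ip_neg_left]
  have k (X Y Z W : SmoothVF E M) : ip (h.curv X Y Z) W = - ip (h.curv X Y W) Z := by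
    rw [h.ip_curv, ip_comm]
  ext x
  have b1 := congrArg (fun f : SmoothFn E M ↦ f x) (b X Y Z W)
  have b2 := congrArg (fun f : SmoothFn E M ↦ f x) (b Y Z W X)
  have b3 := congrArg (fun f : SmoothFn E M ↦ f x) (b Z W X Y)
  have b4 := congrArg (fun f : SmoothFn E M ↦ f x) (b W X Y Z)
  have s' (X Y Z W : SmoothVF E M) := congrArg (fun f : SmoothFn E M ↦ f x) (s X Y Z W)
  have k' (X Y Z W : SmoothVF E M) := congrArg (fun f : SmoothFn E M ↦ f x) (k X Y Z W)
  simp only [ContMDiffMap.coe_add, Pi.add_apply, ContMDiffMap.coe_zero, Pi.zero_apply,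
    ContMDiffMap.coe_neg, Pi.neg_apply] at b1 b2 b3 b4 s' k'
  linarith [s' X Y Z W, k' X Y Z W, s' X Y W Z, s' Y Z X W, k' Y Z X W, s' Y Z W X,
    s' Z X Y W, k' Z X Y W, s' Z X W Y, s' Z W X Y, k' Z W X Y, s' Z W Y X, s' W X Y Z,
    k' W X Y Z, s' W X Z Y, s' W Y Z X, k' W Y Z X, s' W Y X Z, k' Z Y X W, k' X Z Y W,
    k' W Z X Y, k' X W Y Z, k' Y W Z X, k' Y X Z W]

/-- Tensoriality of `R(X, Y) Z` in `Z`. In `g(R(X, Y) Z, W) = -g(Z, R(X, Y) W)` the right-hand side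
only involves the value of `Z` at the point. -/
theorem curv_eq_zero_of_right {X Y Z : SmoothVF E M} {x : M} (hZ : Z x = 0) :
    h.curv X Y Z x = 0 := by
  have e := congrArg (fun f : SmoothFn E M ↦ f x)
    (h.ip_curv X Y Z (h.curv X Y Z))
  simp only [ContMDiffMap.coe_neg, Pi.neg_apply, ip_apply, hZ, inner_zero_left, neg_zero] at e
  exact inner_self_eq_zero.1 e

/-- Tensoriality of `R(X, Y) Z` in `X`, from that in `Z` by the pair symmetry. -/
theorem curv_eq_zero_of_left {X Y Z : SmoothVF E M} {x : M} (hX : X x = 0) :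
    h.curv X Y Z x = 0 := by
  have e := congrArg (fun f : SmoothFn E M ↦ f x)
    (h.ip_curv_pair X Y Z (h.curv X Y Z))
  simp only [ip_apply, h.curv_eq_zero_of_right hX, inner_zero_left] at e
  exact inner_self_eq_zero.1 e

/-- The curvature of smooth vector fields at a point depends only on their values there. -/
theorem curv_congr {X X' Y Y' Z Z' : SmoothVF E M} {x : M} (hX : X x = X' x) (hY : Y x = Y' x)
    (hZ : Z x = Z' x) : h.curv X Y Z x = h.curv X' Y' Z' x := by
  have r (X Y : SmoothVF E M) : h.curv X Y Z x = h.curv X Y Z' x := by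
    have e := h.curv_add X Y (Z - Z') Z'
    rw [sub_add_cancel] at e
    rw [e, ContMDiffSection.coe_add, Pi.add_apply,
      h.curv_eq_zero_of_right (show (Z - Z') x = 0 by simp [hZ]), zero_add]
  have l {X X' : SmoothVF E M} (Y : SmoothVF E M) (hX : X x = X' x) :
      h.curv X Y Z' x = h.curv X' Y Z' x := by
    have e := h.curv_add_left (X - X') X' Y Z'
    rw [sub_add_cancel] at e
    rw [e, ContMDiffSection.coe_add, Pi.add_apply,
      h.curv_eq_zero_of_left (show (X - X') x = 0 by simp [hX]), zero_add]
  rw [r, l Y hX, h.curv_swap, ContMDiffSection.coe_neg, Pi.neg_apply, l X' hY, h.curv_swap Y' X']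
  simp

/-- The curvature tensor, defined through local extensions, computes the curvature of smooth
vector fields. -/
theorem curvatureTensor_eq (X Y Z : SmoothVF E M) (x : M) :
    curvatureTensor cov x (X x) (Y x) (Z x) = h.curv X Y Z x := by
  set U := fieldThrough (X x) with hU
  set V := fieldThrough (Y x) with hV
  set W := fieldThrough (Z x) with hW
  rw [h.curv_congr (X' := U) (Y' := V) (Z' := W) (by simp [hU]) (by simp [hV]) (by simp [hW])]
  have eU := fieldThrough_eventuallyEq (X x)
  have eV := fieldThrough_eventuallyEq (Y x)
  have eW := fieldThrough_eventuallyEq (Z x)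
  -- the extensions agree with global fields near `x`, and the connection is local
  have key : ∀ᶠ y in 𝓝 x, cov (FiberBundle.extend E (Z x)) y = cov W y := by
    filter_upwards [eW.eventually_nhds] with y hy
    refine cov.isCovariantDerivativeOnUniv.congr_of_eventuallyEq ?_ (W.mdiffAt y)
      Filter.univ_mem (hy.mono fun z hz ↦ hz.symm)
    exact (W.mdiffAt y).congr_of_eventuallyEq (hy.mono fun z hz ↦ by simp [← hz, W])
  have inner_eq {A : Π y : M, TangentSpace 𝓘(ℝ, E) y} {A' : SmoothVF E M}
      (hA : ∀ᶠ y in 𝓝 x, A' y = A y) :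
      cov (fun y ↦ cov (FiberBundle.extend E (Z x)) y (A y)) x = cov (h.nabla A' W) x := by
    have e : ∀ᶠ y in 𝓝 x, cov (FiberBundle.extend E (Z x)) y (A y) = h.nabla A' W y := by
      filter_upwards [key, hA] with y h1 h2
      rw [h1, ← h2, nabla_apply]
    refine cov.isCovariantDerivativeOnUniv.congr_of_eventuallyEq ?_ ((h.nabla A' W).mdiffAt x)
      Filter.univ_mem e
    exact ((h.nabla A' W).mdiffAt x).congr_of_eventuallyEq (e.mono fun z hz ↦ by simp [hz])
  have hl : mlieBracket 𝓘(ℝ, E) (FiberBundle.extend E (X x)) (FiberBundle.extend E (Y x)) x =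
      mlieBracket 𝓘(ℝ, E) U V x :=
    Filter.EventuallyEq.mlieBracket_vectorField_eq (eU.mono fun _ hz ↦ hz.symm)
      (eV.mono fun _ hz ↦ hz.symm)
  rw [curvatureTensor, curv_apply]
  simp only [curvature]
  rw [inner_eq eU, inner_eq eV, hl, key.self_of_nhds, ← eU.self_of_nhds, ← eV.self_of_nhds]
  rfl

end IsLeviCivita

end Fields

/-! ### Smooth 1-forms and sections of the tractor bundle -/

section Forms

variable {E : Type*} [NormedAddCommGroup E] [NormedSpace ℝ E] [FiniteDimensional ℝ E]
  {M : Type*} [TopologicalSpace M] [ChartedSpace E M] [IsManifold 𝓘(ℝ, E) ∞ M]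
  {cov : CovariantDerivative 𝓘(ℝ, E) E (TangentSpace 𝓘(ℝ, E) : M → Type _)}

variable (E M) in
/-- Globally defined smooth 1-forms on `M`. -/
abbrev SmoothForm : Type _ := Cₛ^∞⟮𝓘(ℝ, E); E →L[ℝ] ℝ,
  (fun x : M ↦ TangentSpace 𝓘(ℝ, E) x →L[ℝ] Bundle.Trivial M ℝ x)⟯

/-- The smooth function `μ(Z)`. -/
def pair (μ : SmoothForm E M) (Z : SmoothVF E M) : SmoothFn E M :=
  ⟨fun x ↦ μ x (Z x), by
    intro x
    have h := (μ.contMDiff.clm_bundle_apply (E₂ := Bundle.Trivial M ℝ) (F₂ := ℝ) Z.contMDiff) x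
    exact (contMDiffAt_section x).1 h⟩

theorem pair_apply (μ : SmoothForm E M) (Z : SmoothVF E M) (x : M) : pair μ Z x = μ x (Z x) := rfl

/-- A 1-form is smooth if its values on smooth vector fields are smooth. -/
theorem contMDiff_form [T2Space M] (ν : Π x : M, TangentSpace 𝓘(ℝ, E) x →L[ℝ] ℝ)
    (hν : ∀ Z : SmoothVF E M, ContMDiff 𝓘(ℝ, E) 𝓘(ℝ, ℝ) ∞ (fun x ↦ ν x (Z x))) :
    ContMDiff 𝓘(ℝ, E) (𝓘(ℝ, E).prod 𝓘(ℝ, E →L[ℝ] ℝ)) ∞ (fun x ↦ (⟨x, ν x⟩ :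
      TotalSpace (E →L[ℝ] ℝ)
        (fun x : M ↦ TangentSpace 𝓘(ℝ, E) x →L[ℝ] Bundle.Trivial M ℝ x))) := by
  intro x
  rw [contMDiffAt_hom_bundle]
  refine ⟨contMDiffAt_id, ?_⟩
  let b := Module.finBasis ℝ E
  let t := trivializationAt E (TangentSpace 𝓘(ℝ, E) : M → Type _) x
  have hsum : ContMDiffAt 𝓘(ℝ, E) 𝓘(ℝ, E →L[ℝ] ℝ) ∞
      (fun y ↦ ∑ i, (ν y (fieldThrough (t.symm x (b i)) y)) •
        (Module.Basis.coord b i).toContinuousLinearMap) x :=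
    contMDiffAt_finsetSum fun i _ ↦ (hν _ x).smul contMDiffAt_const
  refine hsum.congr_of_eventuallyEq ?_
  have hx : x ∈ t.baseSet := FiberBundle.mem_baseSet_trivializationAt' x
  have hall : ∀ᶠ y in 𝓝 x, ∀ i, fieldThrough (t.symm x (b i)) y =
      FiberBundle.extend E (t.symm x (b i)) y :=
    Filter.eventually_all.2 fun i ↦ fieldThrough_eventuallyEq _
  filter_upwards [hall, t.open_baseSet.mem_nhds hx] with y hy hyt
  ext e
  have he := b.sum_repr e
  conv_lhs => rw [← he]
  simp only [map_sum, map_smul, sum_apply, smul_apply]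
  refine Finset.sum_congr rfl fun i _ ↦ ?_
  rw [hy i]
  simp only [FiberBundle.extend, LinearMap.coe_toContinuousLinearMap',
    Module.Basis.coord_apply, smul_eq_mul]
  rw [mul_comm]
  congr 1
  rw [ContinuousLinearMap.inCoordinates_eq]
  · have e1 := t.apply_mk_symm hx (b i)
    rw [e1]
    simp only [ContinuousLinearMap.comp_apply]
    rfl
  · exact hyt
  · simp

/-- The expression `u (ν(Z)) - ν(∇_u Z)` is tensorial in `Z`. -/
theorem exists_form_linear (ν : SmoothForm E M) (x : M) (u : TangentSpace 𝓘(ℝ, E) x) :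
    ∃ L : TangentSpace 𝓘(ℝ, E) x →L[ℝ] ℝ, ∀ Z : Π y : M, TangentSpace 𝓘(ℝ, E) y,
      MDifferentiableAt 𝓘(ℝ, E) (𝓘(ℝ, E).prod 𝓘(ℝ, E))
        (fun y ↦ (⟨y, Z y⟩ : TotalSpace E (TangentSpace 𝓘(ℝ, E)))) x →
      mvfderiv 𝓘(ℝ, E) (fun y ↦ ν y (Z y)) x u - ν x (cov Z x u) = L (Z x) := by
  have hd {Z : Π y : M, TangentSpace 𝓘(ℝ, E) y}
      (hZ : MDifferentiableAt 𝓘(ℝ, E) (𝓘(ℝ, E).prod 𝓘(ℝ, E))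
        (fun y ↦ (⟨y, Z y⟩ : TotalSpace E (TangentSpace 𝓘(ℝ, E)))) x) :
      MDifferentiableAt 𝓘(ℝ, E) 𝓘(ℝ, ℝ) (fun y ↦ ν y (Z y)) x := by
    have h2 := MDifferentiableAt.clm_bundle_apply (E₂ := Bundle.Trivial M ℝ) (F₂ := ℝ)
      (ν.mdifferentiableAt (x := x)) hZ
    exact (mdifferentiableAt_section _ _).1 h2
  have ht : TensorialAt 𝓘(ℝ, E) E (fun Z : Π y : M, TangentSpace 𝓘(ℝ, E) y ↦
      mvfderiv 𝓘(ℝ, E) (fun y ↦ (ν y (Z y) : ℝ)) x u - (ν x (cov Z x u) : ℝ)) x := by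
    constructor
    · intro f Z hf hZ
      have e : (fun y ↦ (ν y ((f • Z) y) : ℝ)) = fun y ↦ f y * (ν y (Z y) : ℝ) := by
        ext y; simp
      simp only [e, mvfderiv_fun_mul hf (hd hZ), cov.isCovariantDerivativeOnUniv.leibniz hZ hf]
      simp
      ring
    · intro Z Z' hZ hZ'
      have e : (fun y ↦ (ν y ((Z + Z') y) : ℝ)) = fun y ↦ (ν y (Z y) : ℝ) + (ν y (Z' y) : ℝ) := by
        ext y; simp
      simp only [e, mvfderiv_fun_add (hd hZ) (hd hZ'),
        cov.isCovariantDerivativeOnUniv.add hZ hZ']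
      simp
      ring
  exact ⟨TensorialAt.mkHom _ x ht, fun Z hZ ↦ (TensorialAt.mkHom_apply ht hZ).symm⟩

/-- The covariant derivative of a 1-form satisfies the Leibniz rule for the pairing with any
vector field, not only with the frame fields in its definition. -/
theorem nablaOneForm_apply (ν : SmoothForm E M) (Z : SmoothVF E M) (x : M)
    (u : TangentSpace 𝓘(ℝ, E) x) :
    nablaOneForm cov ν x u (Z x) = mvfderiv 𝓘(ℝ, E) (pair ν Z) x u - ν x (cov Z x u) := by
  -- the functional `L` and `∇_u ν` agree on the frame at `x`
  obtain ⟨L, hL⟩ := exists_form_linear (cov := cov) ν x u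
  have h1 : nablaOneForm cov ν x u = L := by
    rw [← expand x L]
    ext v
    simp only [nablaOneForm, sum_apply, smul_apply, ContinuousLinearMap.smulRight_apply]
    refine Finset.sum_congr rfl fun i _ ↦ ?_
    rw [← frame_self, ← hL (frameAt 𝓘(ℝ, E) x i) (FiberBundle.mdifferentiableAt_extend _ _ _)]
    rfl
  rw [h1]
  exact (hL Z (Z.mdiffAt x)).symm

end Forms

section Tractors

variable {E : Type*} [NormedAddCommGroup E] [NormedSpace ℝ E] [FiniteDimensional ℝ E]
  {M : Type*} [TopologicalSpace M] [ChartedSpace E M] [IsManifold 𝓘(ℝ, E) ∞ M]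

/-- The section `(σ, μ, ρ)` of the tractor bundle. -/
def tractor (σ : SmoothFn E M) (μ : SmoothForm E M) (ρ : SmoothFn E M) (x : M) :
    TractorBundle 𝓘(ℝ, E) M x := (σ x, μ x, ρ x)

theorem contMDiff_tractor (σ : SmoothFn E M) (μ : SmoothForm E M) (ρ : SmoothFn E M) :
    ContMDiff 𝓘(ℝ, E) (𝓘(ℝ, E).prod 𝓘(ℝ, TractorFiber E)) ∞
      (fun x ↦ (⟨x, tractor σ μ ρ x⟩ : TotalSpace (TractorFiber E) (TractorBundle 𝓘(ℝ, E) M))) := by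
  intro x
  rw [contMDiffAt_section]
  have h := (contMDiffAt_section x).1 (μ.contMDiff x)
  exact (σ.contMDiff x).prodMk_space (h.prodMk_space (ρ.contMDiff x))

/-- Every smooth section of the tractor bundle has smooth components. -/
theorem exists_tractor_eq {s : Π x : M, TractorBundle 𝓘(ℝ, E) M x}
    (hs : ContMDiff 𝓘(ℝ, E) (𝓘(ℝ, E).prod 𝓘(ℝ, TractorFiber E)) ∞
      (fun x ↦ (⟨x, s x⟩ : TotalSpace (TractorFiber E) (TractorBundle 𝓘(ℝ, E) M)))) :
    ∃ σ μ ρ, s = tractor σ μ ρ := by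
  have h x := (contMDiffAt_section x).1 (hs x)
  have h1 : ContMDiff 𝓘(ℝ, E) 𝓘(ℝ, ℝ) ∞ (fun y ↦ (s y).1) := fun x ↦
    (contDiff_fst.contDiffAt.contMDiffAt (x := (trivializationAt (TractorFiber E)
      (TractorBundle 𝓘(ℝ, E) M) x ⟨x, s x⟩).2)).comp x (h x)
  have h3 : ContMDiff 𝓘(ℝ, E) 𝓘(ℝ, ℝ) ∞ (fun y ↦ (s y).2.2) := fun x ↦
    ((contDiff_snd.comp contDiff_snd).contDiffAt.contMDiffAt (x := (trivializationAt
      (TractorFiber E) (TractorBundle 𝓘(ℝ, E) M) x ⟨x, s x⟩).2)).comp x (h x)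
  have h2 : ContMDiff 𝓘(ℝ, E) (𝓘(ℝ, E).prod 𝓘(ℝ, E →L[ℝ] ℝ)) ∞ (fun y ↦ (⟨y, (s y).2.1⟩ :
      TotalSpace (E →L[ℝ] ℝ)
        (fun x : M ↦ TangentSpace 𝓘(ℝ, E) x →L[ℝ] Bundle.Trivial M ℝ x))) := fun x ↦ by
    rw [contMDiffAt_section]
    exact (ContMDiffAt.comp x ((contDiff_fst.comp contDiff_snd).contDiffAt.contMDiffAt
      (x := (trivializationAt (TractorFiber E) (TractorBundle 𝓘(ℝ, E) M) x ⟨x, s x⟩).2)) (h x) :)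
  exact ⟨⟨_, h1⟩, ⟨_, h2⟩, ⟨_, h3⟩, rfl⟩

end Tractors

/-! ### The complex structure and the Kähler form -/

section Kahler

variable {E : Type*} [NormedAddCommGroup E] [NormedSpace ℝ E] [FiniteDimensional ℝ E]
  {M : Type*} [TopologicalSpace M] [ChartedSpace E M] [IsManifold 𝓘(ℝ, E) ∞ M]
  [RiemannianBundle (fun x : M ↦ TangentSpace 𝓘(ℝ, E) x)]
  [IsContMDiffRiemannianBundle 𝓘(ℝ, E) ∞ E (fun x : M ↦ TangentSpace 𝓘(ℝ, E) x)]
  {cov : CovariantDerivative 𝓘(ℝ, E) E (TangentSpace 𝓘(ℝ, E) : M → Type _)}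
  {J : Π x : M, TangentSpace 𝓘(ℝ, E) x →L[ℝ] TangentSpace 𝓘(ℝ, E) x}

instance (x : M) : FiniteDimensional ℝ (TangentSpace 𝓘(ℝ, E) x) :=
  inferInstanceAs (FiniteDimensional ℝ E)

theorem kahlerForm_apply {x : M} (u v : TangentSpace 𝓘(ℝ, E) x) :
    kahlerForm J x u v = inner ℝ (J x u) v := rfl

namespace IsKahler

variable (hK : IsKahler cov J)
include hK

theorem inner_J_left {x : M} (u v : TangentSpace 𝓘(ℝ, E) x) :
    inner ℝ (J x u) v = -inner ℝ u (J x v) := by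
  rw [← hK.hermitian x (J x u) v, hK.sq_eq_neg, inner_neg_left]

theorem inner_self_J {x : M} (u : TangentSpace 𝓘(ℝ, E) x) :
    inner ℝ u (J x u) = 0 := by
  have := hK.inner_J_left u u
  rw [real_inner_comm] at this
  linarith

theorem isInvertible_kahlerForm (x : M) : (kahlerForm J x).IsInvertible := by
  have : CompleteSpace (TangentSpace 𝓘(ℝ, E) x) := FiniteDimensional.complete ℝ _
  have hb : Function.Bijective (kahlerForm J x).toLinearMap := by
    constructor
    · rw [injective_iff_map_eq_zero]
      intro u hu
      have h1 : kahlerForm J x u (J x u) = 0 := by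
        have := congrArg (fun A : TangentSpace 𝓘(ℝ, E) x →L[ℝ] ℝ ↦ A (J x u)) hu
        simpa using this
      rw [kahlerForm_apply, hK.hermitian] at h1
      exact inner_self_eq_zero.1 h1
    · intro φ
      refine ⟨-J x ((InnerProductSpace.toDual ℝ _).symm φ), ?_⟩
      ext v
      change kahlerForm J x _ v = φ v
      rw [kahlerForm_apply, map_neg, hK.sq_eq_neg, neg_neg, InnerProductSpace.toDual_symm_apply]
  exact ⟨(LinearEquiv.ofBijective _ hb).toContinuousLinearEquiv, rfl⟩

/-- A vector `w` with `Ω(w, ·) = μ` is `μ♯`, since the Kähler form is nondegenerate. -/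
theorem sharp_eq {x : M} {μ : TangentSpace 𝓘(ℝ, E) x →L[ℝ] ℝ} {w : TangentSpace 𝓘(ℝ, E) x}
    (h : ∀ v, μ v = inner ℝ (J x w) v) : sharp (kahlerForm J) x μ = w := by
  rw [sharp, (hK.isInvertible_kahlerForm x).inverse_apply_eq]
  ext v
  exact h v

theorem inner_sharp {x : M} (μ : TangentSpace 𝓘(ℝ, E) x →L[ℝ] ℝ) (u : TangentSpace 𝓘(ℝ, E) x) :
    inner ℝ u (sharp (kahlerForm J) x μ) = μ (J x u) := by
  have h : kahlerForm J x (sharp (kahlerForm J) x μ) = μ :=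
    (hK.isInvertible_kahlerForm x).self_apply_inverse μ
  have := congrArg (fun A : TangentSpace 𝓘(ℝ, E) x →L[ℝ] ℝ ↦ A (J x u)) h
  simp only [kahlerForm_apply, hK.hermitian] at this
  rw [← this, real_inner_comm]

/-- The smooth vector field `J X`. -/
def Jfield (X : SmoothVF E M) : SmoothVF E M :=
  ⟨fun x ↦ J x (X x), hK.smooth.clm_bundle_apply X.contMDiff⟩

theorem Jfield_apply (X : SmoothVF E M) (x : M) : hK.Jfield X x = J x (X x) := rfl

theorem Jfield_sub (X Y : SmoothVF E M) : hK.Jfield (X - Y) = hK.Jfield X - hK.Jfield Y := by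
  ext x; simp [Jfield_apply]

theorem ip_Jfield_left (X Y : SmoothVF E M) : ip (hK.Jfield X) Y = - ip X (hK.Jfield Y) := by
  ext x; exact hK.inner_J_left (X x) (Y x)

theorem nabla_Jfield (X Y : SmoothVF E M) :
    hK.leviCivita.nabla X (hK.Jfield Y) = hK.Jfield (hK.leviCivita.nabla X Y) := by
  ext x
  exact hK.parallel x Y (Y.mdiffAt x) (X x)

theorem curv_Jfield (X Y Z : SmoothVF E M) :
    hK.leviCivita.curv X Y (hK.Jfield Z) = hK.Jfield (hK.leviCivita.curv X Y Z) := by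
  simp only [IsLeviCivita.curv, nabla_Jfield, Jfield_sub]

end IsKahler

/-! ### Lowering an index and differentiating 1-forms -/

theorem pair_sub (μ : SmoothForm E M) (X Y : SmoothVF E M) :
    pair μ (X - Y) = pair μ X - pair μ Y := by
  ext x; exact map_sub (μ x) _ _

theorem pair_add_left (μ ν : SmoothForm E M) (X : SmoothVF E M) :
    pair (μ + ν) X = pair μ X + pair ν X := rfl

variable [T2Space M]

/-- The 1-form `g(X, ·)`. -/
def flat (X : SmoothVF E M) : SmoothForm E M :=
  ⟨fun x ↦ innerSL ℝ (X x), contMDiff_form (fun x ↦ innerSL ℝ (X x)) fun Z ↦ (ip X Z).contMDiff⟩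

theorem flat_apply (X : SmoothVF E M) (x : M) :
    flat X x = innerSL ℝ (X x) := rfl

theorem pair_flat (X Y : SmoothVF E M) : pair (flat X) Y = ip X Y := rfl

/-- The product of a smooth function and a smooth 1-form. -/
def fsmulForm (f : SmoothFn E M) (μ : SmoothForm E M) : SmoothForm E M :=
  ⟨fun x ↦ f x • μ x, f.contMDiff.smul_section μ.contMDiff⟩

theorem pair_fsmulForm (f : SmoothFn E M) (μ : SmoothForm E M) (Y : SmoothVF E M) :
    pair (fsmulForm f μ) Y = f * pair μ Y := rfl

namespace IsLeviCivita

variable (h : IsLeviCivita cov)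
include h

/-- The 1-form `∇_X μ`. -/
def nablaForm (X : SmoothVF E M) (μ : SmoothForm E M) : SmoothForm E M :=
  ⟨fun x ↦ nablaOneForm cov μ x (X x), contMDiff_form (fun x ↦ nablaOneForm cov μ x (X x))
    fun Z ↦ by
      have : (fun x ↦ nablaOneForm cov μ x (X x) (Z x)) =
          (dir X (pair μ Z) - pair μ (h.nabla X Z) : SmoothFn E M) := by
        ext x
        exact nablaOneForm_apply μ Z x (X x)
      rw [this]
      exact ContMDiffMap.contMDiff _⟩

theorem pair_nablaForm (X : SmoothVF E M) (μ : SmoothForm E M) (Z : SmoothVF E M) :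
    pair (h.nablaForm X μ) Z = dir X (pair μ Z) - pair μ (h.nabla X Z) := by
  ext x
  exact nablaOneForm_apply μ Z x (X x)

/-- The Ricci identity for 1-forms. -/
theorem nablaForm_curv [Nontrivial E] (X Y Z : SmoothVF E M) (μ : SmoothForm E M) :
    pair (h.nablaForm X (h.nablaForm Y μ)) Z - pair (h.nablaForm Y (h.nablaForm X μ)) Z
      - pair (h.nablaForm (lie X Y) μ) Z = - pair μ (h.curv X Y Z) := by
  simp only [pair_nablaForm, dir_lie, dir_sub, curv, pair_sub]
  ring

end IsLeviCivita

end Kahler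

/-! ### Hermitian linear algebra of Kähler curvature tensors -/

section Polarization

/-- A curvature-like tensor with the symmetries of a Kähler curvature tensor vanishes as soon as
its holomorphic sectional curvatures do. -/
theorem kahler_polarization {V : Type*} [AddCommGroup V] (J : V →+ V) (hJ : ∀ v, J (J v) = -v)
    (K : V → V → V → V → ℝ)
    (add : ∀ u u' v w z, K (u + u') v w z = K u v w z + K u' v w z)
    (swap : ∀ u v w z, K u v w z = -K v u w z)
    (skew : ∀ u v w z, K u v w z = -K u v z w)
    (pairs : ∀ u v w z, K u v w z = K w z u v)
    (bianchi : ∀ u v w z, K u v w z + K v w u z + K w u v z = 0)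
    (KJ : ∀ u v w z, K u v (J w) (J z) = K u v w z)
    (hol : ∀ v, K v (J v) (J v) v = 0) (u v w z : V) : K u v w z = 0 := by
  have add2 (u v v' w z) : K u (v + v') w z = K u v w z + K u v' w z := by
    rw [swap, add, swap v, swap v']; ring
  have add3 (u v w w' z) : K u v (w + w') z = K u v w z + K u v w' z := by
    rw [pairs, add, pairs w, pairs w']
  have add4 (u v w z z') : K u v w (z + z') = K u v w z + K u v w z' := by
    rw [skew, add3, skew u v z, skew u v z']; ring
  have zero (v w z) : K 0 v w z = 0 := by
    have := add 0 0 v w z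
    simpa using this
  have neg (u v w z) : K (-u) v w z = -K u v w z := by
    have := add (-u) u v w z
    rw [neg_add_cancel, zero] at this
    linarith
  have neg2 (u v w z) : K u (-v) w z = -K u v w z := by rw [swap, neg, swap v, neg_neg]
  have neg3 (u v w z) : K u v (-w) z = -K u v w z := by rw [pairs, neg, pairs w]
  have neg4 (u v w z) : K u v w (-z) = -K u v w z := by rw [skew, neg3, skew u v z, neg_neg]
  have JK (u v w z) : K (J u) (J v) w z = K u v w z := by rw [pairs, KJ, pairs]
  -- the terms of the expansion at `x + y` that are quadratic in both `x` and `y`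
  have quad (x y) : K x y y x + 3 * K x (J y) (J y) x = 0 := by
    have h1 := hol (x + y)
    have h2 := hol (x + -y)
    simp only [map_add, map_neg, add, add2, add3, add4, neg, neg2, neg3, neg4] at h1 h2
    have e1 : K y (J y) (J x) x = K x (J x) (J y) y := by
      rw [pairs, swap, skew]; simp
    have e3 : K x (J y) (J x) y = K x (J y) (J y) x := by
      rw [← KJ x (J y) (J x) y, hJ, neg3, skew]; simp
    have e2 : K y (J x) (J y) x = K x (J y) (J y) x := by
      rw [pairs, swap, skew, neg_neg]; exact e3
    have e4 : K y (J x) (J x) y = K x (J y) (J y) x := by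
      rw [← JK y (J x), hJ, neg2, swap, neg_neg]; exact e3
    have b := bianchi x (J x) (J y) y
    rw [JK, swap (J y) x, e3, skew x y x y] at b
    linarith [hol x, hol y]
  have sec (x y) : K x y y x = 0 := by
    have h1 := quad x y
    have h2 := quad x (J y)
    simp only [hJ, neg2, neg3] at h2
    linarith
  have sec' (x y z) : K x y z x = 0 := by
    have h := sec x (y + z)
    simp only [add2, add3] at h
    have : K x z y x = K x y z x := by rw [pairs, swap, skew]; simp
    linarith [sec x y, sec x z]
  -- `K` is now alternating in the first and last argument, hence totally alternating
  have alt (x y z w) : K x y z w = -K w y z x := by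
    have h := sec' (x + w) y z
    simp only [add, add4] at h
    linarith [sec' x y z, sec' w y z]
  have c (x y z w) : K y z x w = K x y z w := by
    rw [alt y z x w, skew w z x y, alt w z y x, swap x z y w, skew z x y w, alt z x w y,
      pairs y x w z, pairs x y z w]
    have := swap z w x y
    rw [this, skew w z x y, skew w z y x]
    ring
  have := bianchi u v w z
  rw [c u v w z, c v w u z, c u v w z] at this
  linarith

end Polarization

section HermitianAlgebra

variable {V : Type*} [NormedAddCommGroup V] [InnerProductSpace ℝ V]

local notation "⟪" x ", " y "⟫" => inner ℝ x y

theorem inner_J_swap {J : V →L[ℝ] V} (hJ : ∀ u v, ⟪J u, v⟫ = -⟪u, J v⟫) (u v : V) :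
    ⟪J u, v⟫ = -⟪J v, u⟫ := by
  rw [hJ, real_inner_comm]

theorem inner_J_self {J : V →L[ℝ] V} (hJ : ∀ u v, ⟪J u, v⟫ = -⟪u, J v⟫) (u : V) :
    ⟪J u, u⟫ = 0 := by
  linarith [inner_J_swap hJ u u]

/-- The curvature tensor of constant holomorphic sectional curvature `4`. -/
def modelCurv (J : V →L[ℝ] V) (u v w : V) : V :=
  ⟪v, w⟫ • u - ⟪u, w⟫ • v + ⟪J v, w⟫ • J u - ⟪J u, w⟫ • J v - (2 * ⟪J u, v⟫) • J w

theorem inner_modelCurv (J : V →L[ℝ] V) (u v w z : V) :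
    ⟪modelCurv J u v w, z⟫ = ⟪v, w⟫ * ⟪u, z⟫ - ⟪u, w⟫ * ⟪v, z⟫ + ⟪J v, w⟫ * ⟪J u, z⟫
      - ⟪J u, w⟫ * ⟪J v, z⟫ - 2 * ⟪J u, v⟫ * ⟪J w, z⟫ := by
  simp [modelCurv, inner_add_left, inner_sub_left, inner_smul_left]

/-- A tensor with the symmetries of a Kähler curvature tensor is determined by its holomorphic
sectional curvature. -/
theorem eq_smul_modelCurv {J : V →L[ℝ] V} (hJJ : ∀ v, J (J v) = -v)
    (hJ : ∀ u v, ⟪J u, v⟫ = -⟪u, J v⟫) {R : V → V → V → V}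
    (add : ∀ u u' v w, R (u + u') v w = R u v w + R u' v w)
    (swap : ∀ u v w, R u v w = -R v u w)
    (skew : ∀ u v w z, ⟪R u v w, z⟫ = -⟪R u v z, w⟫)
    (pairs : ∀ u v w z, ⟪R u v w, z⟫ = ⟪R w z u, v⟫)
    (bianchi : ∀ u v w, R u v w + R v w u + R w u v = 0)
    (RJ : ∀ u v w, R u v (J w) = J (R u v w)) {a : ℝ}
    (hol : ∀ v, ⟪R v (J v) (J v), v⟫ = 4 * a * (⟪v, v⟫ * ⟪v, v⟫)) (u v w : V) :
    R u v w = a • modelCurv J u v w := by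
  have hJ' (u v) : ⟪J u, J v⟫ = ⟪u, v⟫ := by rw [hJ, hJJ, inner_neg_right, neg_neg]
  refine ext_inner_right ℝ fun z ↦ ?_
  rw [← sub_eq_zero]
  refine kahler_polarization J.toLinearMap.toAddMonoidHom hJJ
    (fun u v w z ↦ ⟪R u v w, z⟫ - ⟪a • modelCurv J u v w, z⟫) ?_ ?_ ?_ ?_ ?_ ?_ ?_ u v w z
  · intro u u' v w z
    simp only [add, inner_smul_left, inner_modelCurv, inner_add_left, map_add]
    ring
  · intro u v w z
    simp only [swap u v, inner_smul_left, inner_modelCurv, inner_neg_left, inner_J_swap hJ u v]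
    ring
  · intro u v w z
    simp only [skew u v w z, inner_smul_left, inner_modelCurv, inner_J_swap hJ w z]
    ring
  · intro u v w z
    simp only [pairs u v w z, inner_smul_left, inner_modelCurv, inner_J_swap hJ w u,
      inner_J_swap hJ z u, inner_J_swap hJ w v, inner_J_swap hJ z v, real_inner_comm w u,
      real_inner_comm w v, real_inner_comm z u, real_inner_comm z v]
    ring
  · intro u v w z
    have b : ⟪R u v w, z⟫ + ⟪R v w u, z⟫ + ⟪R w u v, z⟫ = 0 := by
      rw [← inner_add_left, ← inner_add_left, bianchi, inner_zero_left]
    simp only [inner_smul_left, inner_modelCurv, inner_J_swap hJ w u, inner_J_swap hJ w v,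
      inner_J_swap hJ v u, real_inner_comm u v, real_inner_comm u w, real_inner_comm v w]
    linear_combination b
  · intro u v w z
    change ⟪R u v (J w), J z⟫ - ⟪a • modelCurv J u v (J w), J z⟫ = _
    simp only [RJ, hJ', inner_smul_left, inner_modelCurv, hJJ, inner_neg_left]
    simp only [hJ _ z, hJ _ w]
    ring
  · intro v
    change ⟪R v (J v) (J v), v⟫ - ⟪a • modelCurv J v (J v) (J v), v⟫ = 0
    rw [hol, inner_smul_left, inner_modelCurv, hJ', hJJ, inner_neg_left, inner_J_self hJ]
    have : ⟪v, J v⟫ = 0 := by rw [real_inner_comm, inner_J_self hJ]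
    rw [this]
    simp
    ring

variable [FiniteDimensional ℝ V]

theorem exists_orthogonal_pair (hdim : 2 < Module.finrank ℝ V) (w w' : V) :
    ∃ u : V, u ≠ 0 ∧ ⟪u, w⟫ = 0 ∧ ⟪u, w'⟫ = 0 := by
  classical
  let P : Submodule ℝ V := Submodule.span ℝ ({w, w'} : Finset V)
  have hP : Module.finrank ℝ P ≤ 2 := (finrank_span_finset_le_card _).trans Finset.card_le_two
  have hne : Pᗮ ≠ ⊥ := by
    intro h
    have := P.finrank_add_finrank_orthogonal
    rw [h, finrank_bot] at this
    omega
  obtain ⟨u, hu, hu0⟩ := Submodule.exists_mem_ne_zero_of_ne_bot hne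
  exact ⟨u, hu0, (Submodule.mem_orthogonal' P u).1 hu w (Submodule.subset_span (by simp)),
    (Submodule.mem_orthogonal' P u).1 hu w' (Submodule.subset_span (by simp))⟩

/-- A symmetric bilinear form for which vectors spanning orthogonal complex lines are orthogonal
is a multiple of the metric, if the complex dimension is at least two. -/
theorem eq_smul_inner_of_orthogonal {J : V →L[ℝ] V} (hJJ : ∀ v, J (J v) = -v)
    (hJ : ∀ u v, ⟪J u, v⟫ = -⟪u, J v⟫) (hdim : 2 < Module.finrank ℝ V)
    (B : V →L[ℝ] V →L[ℝ] ℝ) (symm : ∀ u v, B u v = B v u)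
    (orth : ∀ u v, ⟪u, v⟫ = 0 → ⟪u, J v⟫ = 0 → B u v = 0) :
    ∃ a : ℝ, ∀ u v, B u v = a * ⟪u, v⟫ := by
  have : Nontrivial V := Module.nontrivial_of_finrank_pos (R := ℝ) (by omega)
  have hJ0 (u) : ⟪u, J u⟫ = 0 := by rw [real_inner_comm, inner_J_self hJ]
  -- vectors in orthogonal complex lines have the same value of `B(v, v) / |v|²`
  have scale (a b : V) (h1 : ⟪b, a⟫ = 0) (h2 : ⟪b, J a⟫ = 0) :
      B a a * ⟪b, b⟫ = B b b * ⟪a, a⟫ := by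
    have k := orth (‖b‖ • a + ‖a‖ • b) (‖b‖ • a - ‖a‖ • b) ?_ ?_
    · simp only [map_add, map_sub, map_smul, add_apply, smul_apply, smul_eq_mul] at k
      rw [symm b a] at k
      rw [real_inner_self_eq_norm_sq, real_inner_self_eq_norm_sq]
      linear_combination k
    · simp only [inner_add_left, inner_sub_right, inner_smul_left, inner_smul_right,
        real_inner_self_eq_norm_sq, h1, real_inner_comm b a]
      simp
      ring
    · have h3 : ⟪a, J b⟫ = 0 := by
        have := hJ a b
        rw [real_inner_comm, h2] at this
        linarith
      simp [inner_add_left, inner_sub_right, inner_smul_left, inner_smul_right, h2, h3, hJ0]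
  obtain ⟨e, he⟩ := exists_ne (0 : V)
  obtain ⟨b, hb, hbe, hbJ⟩ := exists_orthogonal_pair hdim e (J e)
  have he' : ⟪e, e⟫ ≠ 0 := inner_self_ne_zero.2 he
  have hb' : ⟪b, b⟫ ≠ 0 := inner_self_ne_zero.2 hb
  have hJe : ⟪J e, J e⟫ = ⟪e, e⟫ := by rw [hJ, hJJ, inner_neg_right, neg_neg]
  set a := B e e / ⟪e, e⟫ with ha
  have hBe : B e e = a * ⟪e, e⟫ := by rw [ha]; field_simp
  have diag (w : V) : B w w = a * ⟪w, w⟫ := by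
    set s := ⟪e, w⟫ / ⟪e, e⟫ with hs
    set t := ⟪J e, w⟫ / ⟪e, e⟫ with ht
    set p := s • e + t • J e with hp
    set u := w - p with hu
    have hpJ : J p = s • J e - t • e := by simp [hp, hJJ, sub_eq_add_neg]
    have hue : ⟪u, e⟫ = 0 := by
      simp only [hu, hp, inner_sub_left, inner_add_left, inner_smul_left, inner_J_self hJ]
      rw [real_inner_comm, hs]
      simp
      field_simp
      ring
    have huJ : ⟪u, J e⟫ = 0 := by
      simp only [hu, hp, inner_sub_left, inner_add_left, inner_smul_left, hJ0, hJe]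
      rw [real_inner_comm, ht]
      simp
      field_simp
      ring
    have hup : ⟪u, p⟫ = 0 := by simp [hp, inner_add_right, inner_smul_right, hue, huJ]
    have huJp : ⟪u, J p⟫ = 0 := by
      simp [hpJ, inner_sub_right, inner_smul_right, hue, huJ]
    have k1 := scale e u hue huJ
    have k2 := scale e b hbe hbJ
    have k3 := scale p b (by simp [hp, inner_add_right, inner_smul_right, hbe, hbJ])
      (by simp [hpJ, inner_sub_right, inner_smul_right, hbe, hbJ])
    have k4 := orth u p hup huJp
    have hBu : B u u = a * ⟪u, u⟫ := by
      apply mul_right_cancel₀ he'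
      rw [← k1, hBe]; ring
    have hBb : B b b = a * ⟪b, b⟫ := by
      apply mul_right_cancel₀ he'
      rw [← k2, hBe]; ring
    have hBp : B p p = a * ⟪p, p⟫ := by
      apply mul_right_cancel₀ hb'
      rw [k3, hBb]; ring
    have hw : w = u + p := by simp [hu]
    rw [hw]
    simp only [map_add, add_apply, inner_add_left, inner_add_right, symm p u, k4, hBu, hBp, hup,
      real_inner_comm u p]
    ring
  refine ⟨a, fun u v ↦ ?_⟩
  have h := diag (u + v)
  simp only [map_add, add_apply, inner_add_left, inner_add_right, symm v u, diag u, diag v,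
    real_inner_comm u v] at h
  linarith

/-- The trace of an endomorphism that is skew for the metric vanishes. -/
theorem trace_eq_zero_of_skew (A : V →ₗ[ℝ] V) (hA : ∀ u, ⟪A u, u⟫ = 0) :
    LinearMap.trace ℝ V A = 0 := by
  rw [LinearMap.trace_eq_sum_inner A (stdOrthonormalBasis ℝ V)]
  refine Finset.sum_eq_zero fun i _ ↦ ?_
  rw [real_inner_comm, hA]

end HermitianAlgebra

/-! ### Symmetries of the curvature tensor -/

section Kahler

variable {E : Type*} [NormedAddCommGroup E] [NormedSpace ℝ E] [FiniteDimensional ℝ E]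
  {M : Type*} [TopologicalSpace M] [ChartedSpace E M] [IsManifold 𝓘(ℝ, E) ∞ M]
  [RiemannianBundle (fun x : M ↦ TangentSpace 𝓘(ℝ, E) x)]
  [IsContMDiffRiemannianBundle 𝓘(ℝ, E) ∞ E (fun x : M ↦ TangentSpace 𝓘(ℝ, E) x)]
  {cov : CovariantDerivative 𝓘(ℝ, E) E (TangentSpace 𝓘(ℝ, E) : M → Type _)}
  {J : Π x : M, TangentSpace 𝓘(ℝ, E) x →L[ℝ] TangentSpace 𝓘(ℝ, E) x}
  [T2Space M] [Nontrivial E]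

namespace IsLeviCivita

variable (h : IsLeviCivita cov) {x : M}
include h

theorem curvatureTensor_add_left (u u' v w : TangentSpace 𝓘(ℝ, E) x) :
    curvatureTensor cov x (u + u') v w =
      curvatureTensor cov x u v w + curvatureTensor cov x u' v w := by
  have e := h.curvatureTensor_eq (fieldThrough u + fieldThrough u') (fieldThrough v)
    (fieldThrough w) x
  have e1 := h.curvatureTensor_eq (fieldThrough u) (fieldThrough v) (fieldThrough w) x
  have e2 := h.curvatureTensor_eq (fieldThrough u') (fieldThrough v) (fieldThrough w) x
  simp only [ContMDiffSection.coe_add, Pi.add_apply, fieldThrough_self, h.curv_add_left] at e e1 e2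
  rw [e, e1, e2]

theorem curvatureTensor_add_right (u v w w' : TangentSpace 𝓘(ℝ, E) x) :
    curvatureTensor cov x u v (w + w') =
      curvatureTensor cov x u v w + curvatureTensor cov x u v w' := by
  have e := h.curvatureTensor_eq (fieldThrough u) (fieldThrough v)
    (fieldThrough w + fieldThrough w') x
  have e1 := h.curvatureTensor_eq (fieldThrough u) (fieldThrough v) (fieldThrough w) x
  have e2 := h.curvatureTensor_eq (fieldThrough u) (fieldThrough v) (fieldThrough w') x
  simp only [ContMDiffSection.coe_add, Pi.add_apply, fieldThrough_self, h.curv_add] at e e1 e2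
  rw [e, e1, e2]

theorem curvatureTensor_smul_right (u v w : TangentSpace 𝓘(ℝ, E) x) (c : ℝ) :
    curvatureTensor cov x u v (c • w) = c • curvatureTensor cov x u v w := by
  have e := h.curvatureTensor_eq (fieldThrough u) (fieldThrough v) (c • fieldThrough w) x
  have e1 := h.curvatureTensor_eq (fieldThrough u) (fieldThrough v) (fieldThrough w) x
  simp only [ContMDiffSection.coe_smul, Pi.smul_apply, fieldThrough_self, h.curv_smul] at e e1
  rw [e, e1]

theorem curvatureTensor_swap (u v w : TangentSpace 𝓘(ℝ, E) x) :
    curvatureTensor cov x u v w = -curvatureTensor cov x v u w := by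
  have e1 := h.curvatureTensor_eq (fieldThrough u) (fieldThrough v) (fieldThrough w) x
  have e2 := h.curvatureTensor_eq (fieldThrough v) (fieldThrough u) (fieldThrough w) x
  rw [h.curv_swap] at e1
  simp only [ContMDiffSection.coe_neg, Pi.neg_apply, fieldThrough_self] at e1 e2
  rw [e1, e2]

theorem curvatureTensor_bianchi (u v w : TangentSpace 𝓘(ℝ, E) x) :
    curvatureTensor cov x u v w + curvatureTensor cov x v w u
      + curvatureTensor cov x w u v = 0 := by
  have e1 := h.curvatureTensor_eq (fieldThrough u) (fieldThrough v) (fieldThrough w) x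
  have e2 := h.curvatureTensor_eq (fieldThrough v) (fieldThrough w) (fieldThrough u) x
  have e3 := h.curvatureTensor_eq (fieldThrough w) (fieldThrough u) (fieldThrough v) x
  have b := congrArg (fun X : SmoothVF E M ↦ X x)
    (h.bianchi (fieldThrough u) (fieldThrough v) (fieldThrough w))
  simp only [fieldThrough_self] at e1 e2 e3
  rw [e1, e2, e3]
  exact b

theorem inner_curvatureTensor (u v w z : TangentSpace 𝓘(ℝ, E) x) :
    inner ℝ (curvatureTensor cov x u v w) z = -inner ℝ (curvatureTensor cov x u v z) w := by
  have e1 := h.curvatureTensor_eq (fieldThrough u) (fieldThrough v) (fieldThrough w) x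
  have e2 := h.curvatureTensor_eq (fieldThrough u) (fieldThrough v) (fieldThrough z) x
  have b := congrArg (fun f : SmoothFn E M ↦ f x)
    (h.ip_curv (fieldThrough u) (fieldThrough v) (fieldThrough w) (fieldThrough z))
  simp only [fieldThrough_self, ip_apply, ContMDiffMap.coe_neg, Pi.neg_apply] at e1 e2 b
  rw [e1, e2, b, real_inner_comm]

theorem inner_curvatureTensor_pair (u v w z : TangentSpace 𝓘(ℝ, E) x) :
    inner ℝ (curvatureTensor cov x u v w) z = inner ℝ (curvatureTensor cov x w z u) v := by
  have e1 := h.curvatureTensor_eq (fieldThrough u) (fieldThrough v) (fieldThrough w) x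
  have e2 := h.curvatureTensor_eq (fieldThrough w) (fieldThrough z) (fieldThrough u) x
  have b := congrArg (fun f : SmoothFn E M ↦ f x)
    (h.ip_curv_pair (fieldThrough u) (fieldThrough v) (fieldThrough w) (fieldThrough z))
  simp only [fieldThrough_self, ip_apply] at e1 e2 b
  rw [e1, e2, b]

theorem inner_curvatureTensor_self (u v w : TangentSpace 𝓘(ℝ, E) x) :
    inner ℝ (curvatureTensor cov x u v w) w = 0 := by
  linarith [h.inner_curvatureTensor u v w w]

end IsLeviCivita

theorem IsKahler.curvatureTensor_J (hK : IsKahler cov J) {x : M}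
    (u v w : TangentSpace 𝓘(ℝ, E) x) :
    curvatureTensor cov x u v (J x w) = J x (curvatureTensor cov x u v w) := by
  have e1 := hK.leviCivita.curvatureTensor_eq (fieldThrough u) (fieldThrough v)
    (hK.Jfield (fieldThrough w)) x
  have e2 := hK.leviCivita.curvatureTensor_eq (fieldThrough u) (fieldThrough v) (fieldThrough w) x
  rw [hK.curv_Jfield] at e1
  simp only [fieldThrough_self, IsKahler.Jfield_apply] at e1 e2
  rw [e1, e2]

/-! ### The Ricci tensor -/

theorem clm₂_ext_basis {x : M} {B C : TangentSpace 𝓘(ℝ, E) x →L[ℝ] TangentSpace 𝓘(ℝ, E) x →L[ℝ] ℝ}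
    (h : ∀ i j, B (basisAt 𝓘(ℝ, E) x i) (basisAt 𝓘(ℝ, E) x j) =
      C (basisAt 𝓘(ℝ, E) x i) (basisAt 𝓘(ℝ, E) x j)) : B = C := by
  refine ContinuousLinearMap.coe_injective ((basisAt 𝓘(ℝ, E) x).ext fun i ↦ ?_)
  exact ContinuousLinearMap.coe_injective ((basisAt 𝓘(ℝ, E) x).ext fun j ↦ h i j)

theorem dualBasisAt_basisAt {x : M} (i j : Fin (Module.finrank ℝ E)) :
    dualBasisAt 𝓘(ℝ, E) x i (basisAt 𝓘(ℝ, E) x j) = if j = i then 1 else 0 := by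
  classical
  change (Module.finBasis ℝ E).repr (Module.finBasis ℝ E j) i = _
  rw [Module.Basis.repr_self, Finsupp.single_apply]

/-- The trace in the components used for the Ricci tensor is the trace of linear algebra. -/
theorem sum_dualBasisAt {x : M} (A : TangentSpace 𝓘(ℝ, E) x →ₗ[ℝ] TangentSpace 𝓘(ℝ, E) x) :
    ∑ k, dualBasisAt 𝓘(ℝ, E) x k (A (basisAt 𝓘(ℝ, E) x k)) = LinearMap.trace ℝ _ A := by
  classical
  rw [LinearMap.trace_eq_matrix_trace ℝ (basisAt 𝓘(ℝ, E) x), Matrix.trace]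
  refine Finset.sum_congr rfl fun k _ ↦ ?_
  rw [Matrix.diag_apply, LinearMap.toMatrix_apply]
  rfl

theorem ricci_basis {x : M} (i j : Fin (Module.finrank ℝ E)) :
    ricci cov x (basisAt 𝓘(ℝ, E) x i) (basisAt 𝓘(ℝ, E) x j) =
      ∑ k, dualBasisAt 𝓘(ℝ, E) x k (curvatureTensor cov x (basisAt 𝓘(ℝ, E) x k)
        (basisAt 𝓘(ℝ, E) x i) (basisAt 𝓘(ℝ, E) x j)) := by
  simp [ricci, dualBasisAt_basisAt]

/-- The Ricci tensor is symmetric: by the first Bianchi identity, its skew part is the trace of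
`R(u, v)`, which is skew for the metric. -/
theorem IsLeviCivita.ricci_symm (h : IsLeviCivita cov) {x : M} (u v : TangentSpace 𝓘(ℝ, E) x) :
    ricci cov x u v = ricci cov x v u := by
  suffices ricci cov x = (ricci cov x).flip by
    conv_lhs => rw [this]
    rfl
  refine clm₂_ext_basis fun i j ↦ ?_
  rw [ContinuousLinearMap.flip_apply, ricci_basis, ricci_basis, ← sub_eq_zero,
    ← Finset.sum_sub_distrib]
  let A : TangentSpace 𝓘(ℝ, E) x →ₗ[ℝ] TangentSpace 𝓘(ℝ, E) x :=
    { toFun := curvatureTensor cov x (basisAt 𝓘(ℝ, E) x i) (basisAt 𝓘(ℝ, E) x j)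
      map_add' := h.curvatureTensor_add_right _ _
      map_smul' := fun c w ↦ h.curvatureTensor_smul_right _ _ w c }
  have hA : LinearMap.trace ℝ _ A = 0 :=
    trace_eq_zero_of_skew A fun u ↦ h.inner_curvatureTensor_self _ _ u
  rw [← neg_zero, ← hA, ← sum_dualBasisAt, ← Finset.sum_neg_distrib]
  refine Finset.sum_congr rfl fun k _ ↦ ?_
  rw [← map_sub, ← map_neg]
  congr 1
  have b := h.curvatureTensor_bianchi (basisAt 𝓘(ℝ, E) x k) (basisAt 𝓘(ℝ, E) x i)
    (basisAt 𝓘(ℝ, E) x j)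
  rw [h.curvatureTensor_swap (basisAt 𝓘(ℝ, E) x j)] at b
  change _ = -curvatureTensor cov x _ _ _
  rw [eq_neg_iff_add_eq_zero, ← b]
  abel

/-- The Ricci tensor of `a` times the model is `2 a (n + 1) g`: the identity contributes `2 n`, the
rank-one terms contribute `-1 + 1 + 2`, and `J` is trace-free. -/
theorem IsKahler.Phi_eq_of_model (hK : IsKahler cov J) {x : M} {a : ℝ}
    (hR : ∀ u v w, curvatureTensor cov x u v w = a • modelCurv (J x) u v w) :
    Phi cov x = a • innerSL ℝ := by
  have hJ : ∀ u v : TangentSpace 𝓘(ℝ, E) x, inner ℝ (J x u) v = -inner ℝ u (J x v) :=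
    hK.inner_J_left
  have hric : ricci cov x = (a * ((Module.finrank ℝ E : ℝ) + 2)) • innerSL ℝ := by
    refine clm₂_ext_basis fun i j ↦ ?_
    rw [ricci_basis]
    set v := basisAt 𝓘(ℝ, E) x i
    set w := basisAt 𝓘(ℝ, E) x j
    let A : TangentSpace 𝓘(ℝ, E) x →ₗ[ℝ] TangentSpace 𝓘(ℝ, E) x :=
      inner ℝ v w • LinearMap.id - ((innerSL ℝ w).toLinearMap.smulRight v)
        + inner ℝ (J x v) w • (J x).toLinearMap
        + ((innerSL ℝ (J x w)).toLinearMap.smulRight (J x v))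
        + ((2 : ℝ) • (innerSL ℝ (J x v)).toLinearMap.smulRight (J x w))
    have hA k : curvatureTensor cov x (basisAt 𝓘(ℝ, E) x k) v w =
        a • A (basisAt 𝓘(ℝ, E) x k) := by
      rw [hR]
      congr 1
      set e := basisAt 𝓘(ℝ, E) x k
      simp only [A, modelCurv, LinearMap.add_apply, LinearMap.sub_apply, LinearMap.smul_apply,
        LinearMap.id_apply, LinearMap.smulRight_apply, ContinuousLinearMap.coe_coe,
        innerSL_apply_apply, inner_J_swap hJ e, real_inner_comm e w]
      module
    have htr : LinearMap.trace ℝ _ A = ((Module.finrank ℝ E : ℝ) + 2) * inner ℝ v w := by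
      have hJ0 : LinearMap.trace ℝ _ (J x).toLinearMap = 0 :=
        trace_eq_zero_of_skew _ (inner_J_self hJ)
      have hid : LinearMap.trace ℝ _ (LinearMap.id : TangentSpace 𝓘(ℝ, E) x →ₗ[ℝ] _) =
          Module.finrank ℝ E := LinearMap.trace_id ℝ E
      simp only [A, map_add, map_sub, map_smul, hJ0, hid, LinearMap.trace_smulRight,
        ContinuousLinearMap.coe_coe, innerSL_apply_apply, smul_eq_mul, hK.hermitian,
        real_inner_comm v w]
      ring
    simp only [hA, map_smul, ← Finset.smul_sum]
    rw [sum_dualBasisAt, htr]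
    change a * _ = a * _ * inner ℝ v w
    ring
  rw [Phi, hric, smul_smul]
  congr 1
  have : (Module.finrank ℝ E : ℝ) + 2 ≠ 0 := by positivity
  field_simp

end Kahler

/-! ### The curvature of the tractor connection -/

section Kahler

variable {E : Type*} [NormedAddCommGroup E] [NormedSpace ℝ E] [FiniteDimensional ℝ E]
  {M : Type*} [TopologicalSpace M] [ChartedSpace E M] [IsManifold 𝓘(ℝ, E) ∞ M]
  [RiemannianBundle (fun x : M ↦ TangentSpace 𝓘(ℝ, E) x)]
  [IsContMDiffRiemannianBundle 𝓘(ℝ, E) ∞ E (fun x : M ↦ TangentSpace 𝓘(ℝ, E) x)]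
  {cov : CovariantDerivative 𝓘(ℝ, E) E (TangentSpace 𝓘(ℝ, E) : M → Type _)}
  {J : Π x : M, TangentSpace 𝓘(ℝ, E) x →L[ℝ] TangentSpace 𝓘(ℝ, E) x}

theorem tractor_fst (Ω : Π x : M, TangentSpace 𝓘(ℝ, E) x →L[ℝ] TangentSpace 𝓘(ℝ, E) x →L[ℝ] ℝ)
    (s : Π x : M, TractorBundle 𝓘(ℝ, E) M x) (x : M) (u : TangentSpace 𝓘(ℝ, E) x) :
    (tractorConnection cov Ω s x u).1 = mvfderiv 𝓘(ℝ, E) (fun y ↦ (s y).1) x u - (s x).2.1 u :=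
  rfl

theorem tractor_snd (Ω : Π x : M, TangentSpace 𝓘(ℝ, E) x →L[ℝ] TangentSpace 𝓘(ℝ, E) x →L[ℝ] ℝ)
    (s : Π x : M, TractorBundle 𝓘(ℝ, E) M x) (x : M) (u : TangentSpace 𝓘(ℝ, E) x) :
    (tractorConnection cov Ω s x u).2.1 = nablaOneForm cov (fun y ↦ (s y).2.1) x u
      + (s x).2.2 • Ω x u + (s x).1 • Phi cov x u :=
  rfl

theorem tractor_trd (Ω : Π x : M, TangentSpace 𝓘(ℝ, E) x →L[ℝ] TangentSpace 𝓘(ℝ, E) x →L[ℝ] ℝ)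
    (s : Π x : M, TractorBundle 𝓘(ℝ, E) M x) (x : M) (u : TangentSpace 𝓘(ℝ, E) x) :
    (tractorConnection cov Ω s x u).2.2 = mvfderiv 𝓘(ℝ, E) (fun y ↦ (s y).2.2) x u
      - Phi cov x u (sharp Ω x (s x).2.1) + (s x).1 * S cov Ω x u :=
  rfl

theorem mvfderiv_zero_apply (x : M) (u : TangentSpace 𝓘(ℝ, E) x) (c : ℝ) :
    mvfderiv 𝓘(ℝ, E) (fun _ : M ↦ c) x u = 0 :=
  congrArg (fun A ↦ A u) (mvfderiv_const (I := 𝓘(ℝ, E)) c (x := x))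

theorem curvature_snd (D : CovariantDerivative 𝓘(ℝ, E) (TractorFiber E)
      (TractorBundle 𝓘(ℝ, E) M)) (X Y Z : Π x : M, TangentSpace 𝓘(ℝ, E) x)
    (s : Π x : M, TractorBundle 𝓘(ℝ, E) M x) (x : M) :
    (curvature D X Y s x).2.1 (Z x) =
      (D (fun y ↦ D s y (Y y)) x (X x)).2.1 (Z x) - (D (fun y ↦ D s y (X y)) x (Y x)).2.1 (Z x)
        - (D s x (mlieBracket 𝓘(ℝ, E) X Y x)).2.1 (Z x) := rfl

variable [T2Space M] [Nontrivial E]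

/-- The 1-form component of the tractor curvature on a section `(0, μ, 0)`. The derivatives of `μ`
combine to the curvature of `M`, and those of `Φ` do not enter. -/
theorem curvature_tractor_form (h : IsLeviCivita cov) (X Y Z : SmoothVF E M) (μ : SmoothForm E M)
    (Ω : Π x : M, TangentSpace 𝓘(ℝ, E) x →L[ℝ] TangentSpace 𝓘(ℝ, E) x →L[ℝ] ℝ) (x : M) :
    (curvature (tractorConnection cov Ω) X Y (tractor 0 μ 0) x).2.1 (Z x) =
      -μ x (h.curv X Y Z x) - Ω x (X x) (Z x) * Phi cov x (Y x) (sharp Ω x (μ x))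
      + Ω x (Y x) (Z x) * Phi cov x (X x) (sharp Ω x (μ x))
      - Phi cov x (X x) (Z x) * μ x (Y x) + Phi cov x (Y x) (Z x) * μ x (X x) := by
  have mid (A : SmoothVF E M) (y : M) :
      (tractorConnection cov Ω (tractor 0 μ 0) y (A y)).2.1 = h.nablaForm A μ y := by
    rw [tractor_snd]
    change h.nablaForm A μ y + (0 : ℝ) • _ + (0 : ℝ) • _ = _
    rw [zero_smul, zero_smul, add_zero, add_zero]
  have fst (A : SmoothVF E M) :
      (tractorConnection cov Ω (tractor 0 μ 0) x (A x)).1 = -μ x (A x) := by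
    rw [tractor_fst]
    change mvfderiv 𝓘(ℝ, E) (fun _ ↦ (0 : ℝ)) x (A x) - μ x (A x) = _
    rw [mvfderiv_zero_apply, zero_sub]
  have trd (A : SmoothVF E M) : (tractorConnection cov Ω (tractor 0 μ 0) x (A x)).2.2 =
      -Phi cov x (A x) (sharp Ω x (μ x)) := by
    rw [tractor_trd]
    change mvfderiv 𝓘(ℝ, E) (fun _ ↦ (0 : ℝ)) x (A x) - _ + 0 * _ = _
    rw [mvfderiv_zero_apply, zero_sub, zero_mul, add_zero]
    rfl
  have key (A B : SmoothVF E M) : (tractorConnection cov Ω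
      (fun y ↦ tractorConnection cov Ω (tractor 0 μ 0) y (A y)) x (B x)).2.1 (Z x) =
      pair (h.nablaForm B (h.nablaForm A μ)) Z x
        - Ω x (B x) (Z x) * Phi cov x (A x) (sharp Ω x (μ x))
        - Phi cov x (B x) (Z x) * μ x (A x) := by
    rw [tractor_snd]
    simp only [mid, fst, trd]
    change h.nablaForm B (h.nablaForm A μ) x (Z x) + (-_) * Ω x (B x) (Z x)
      + (-_) * Phi cov x (B x) (Z x) = h.nablaForm B (h.nablaForm A μ) x (Z x) - _ - _
    ring
  rw [curvature_snd, key, key]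
  have c := congrArg (fun f : SmoothFn E M ↦ f x) (h.nablaForm_curv X Y Z μ)
  have e : (tractorConnection cov Ω (tractor 0 μ 0) x (mlieBracket 𝓘(ℝ, E) X Y x)).2.1 (Z x) =
    pair (h.nablaForm (lie X Y) μ) Z x := congrArg (fun A ↦ A (Z x)) (mid (lie X Y) x)
  rw [e]
  change pair (h.nablaForm X (h.nablaForm Y μ)) Z x - pair (h.nablaForm Y (h.nablaForm X μ)) Z x
      - pair (h.nablaForm (lie X Y) μ) Z x = -μ x (h.curv X Y Z x) at c
  linear_combination c

/-- The 1-form component of the tractor curvature on the section `(1, 0, 0)`, if the Ricci tensor is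
a smooth multiple of the metric. It detects the derivative of the factor. -/
theorem curvature_tractor_one (h : IsLeviCivita cov) {a : SmoothFn E M}
    (ha : ∀ x, Phi cov x = a x • innerSL ℝ) (X Y Z : SmoothVF E M)
    (Ω : Π x : M, TangentSpace 𝓘(ℝ, E) x →L[ℝ] TangentSpace 𝓘(ℝ, E) x →L[ℝ] ℝ) (x : M) :
    (curvature (tractorConnection cov Ω) X Y (tractor 1 0 0) x).2.1 (Z x) =
      dir X a x * inner ℝ (Y x) (Z x) - dir Y a x * inner ℝ (X x) (Z x)
      + S cov Ω x (Y x) * Ω x (X x) (Z x) - S cov Ω x (X x) * Ω x (Y x) (Z x) := by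
  have nz (A : SmoothVF E M) (y : M) :
      nablaOneForm cov (fun z ↦ (tractor (1 : SmoothFn E M) 0 0 z).2.1) y (A y) = 0 := by
    have h0 : ∀ B : SmoothVF E M, pair (0 : SmoothForm E M) B = 0 := fun B ↦ rfl
    ext v
    have := congrArg (fun f : SmoothFn E M ↦ f y) (h.pair_nablaForm A 0 (fieldThrough v))
    rw [h0, h0] at this
    simp only [pair_apply, fieldThrough_self] at this
    refine this.trans ?_
    have hd : dir A (0 : SmoothFn E M) = 0 := by simpa using dir_add A 0 0
    rw [hd, sub_zero]
    rfl
  have mid (A : SmoothVF E M) (y : M) :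
      (tractorConnection cov Ω (tractor 1 0 0) y (A y)).2.1 = fsmulForm a (flat A) y := by
    rw [tractor_snd, nz, ha]
    change 0 + (0 : ℝ) • Ω y (A y) + (1 : ℝ) • a y • innerSL ℝ (A y) = a y • innerSL ℝ (A y)
    rw [zero_smul, one_smul, add_zero, zero_add]
  have fst (A : SmoothVF E M) :
      (tractorConnection cov Ω (tractor 1 0 0) x (A x)).1 = 0 := by
    rw [tractor_fst]
    change mvfderiv 𝓘(ℝ, E) (fun _ ↦ (1 : ℝ)) x (A x) - 0 = _
    rw [mvfderiv_zero_apply, zero_sub, neg_zero]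
  have trd (A : SmoothVF E M) : (tractorConnection cov Ω (tractor 1 0 0) x (A x)).2.2 =
      S cov Ω x (A x) := by
    rw [tractor_trd]
    change mvfderiv 𝓘(ℝ, E) (fun _ ↦ (0 : ℝ)) x (A x) - Phi cov x (A x) (sharp Ω x 0) + 1 * _ = _
    rw [mvfderiv_zero_apply, map_zero, map_zero, sub_zero, zero_add, one_mul]
  have key (A B : SmoothVF E M) : (tractorConnection cov Ω
      (fun y ↦ tractorConnection cov Ω (tractor 1 0 0) y (A y)) x (B x)).2.1 (Z x) =
      pair (h.nablaForm B (fsmulForm a (flat A))) Z x + S cov Ω x (A x) * Ω x (B x) (Z x) := by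
    rw [tractor_snd]
    simp only [mid, fst, trd]
    change h.nablaForm B (fsmulForm a (flat A)) x (Z x) + _ * Ω x (B x) (Z x) + 0 * _ =
      h.nablaForm B (fsmulForm a (flat A)) x (Z x) + _
    ring
  have e : (tractorConnection cov Ω (tractor 1 0 0) x (mlieBracket 𝓘(ℝ, E) X Y x)).2.1 (Z x) =
    pair (fsmulForm a (flat (lie X Y))) Z x := congrArg (fun A ↦ A (Z x)) (mid (lie X Y) x)
  rw [curvature_snd, key, key, e]
  have c : pair (h.nablaForm X (fsmulForm a (flat Y))) Z
      - pair (h.nablaForm Y (fsmulForm a (flat X))) Z - pair (fsmulForm a (flat (lie X Y))) Z =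
      dir X a * ip Y Z - dir Y a * ip X Z := by
    simp only [h.pair_nablaForm, pair_fsmulForm, pair_flat, dir_mul, h.dir_ip,
      ← h.nabla_sub_nabla X Y, ip_sub_left]
    ring
  have c' := congrArg (fun f : SmoothFn E M ↦ f x) c
  change _ - _ - _ = dir X a x * inner ℝ (Y x) (Z x) - dir Y a x * inner ℝ (X x) (Z x) at c'
  linear_combination c'

end Kahler

/-! ### From symplectic flatness to constant holomorphic sectional curvature -/

section HermitianAlgebra

variable {V : Type*} [NormedAddCommGroup V] [InnerProductSpace ℝ V] [FiniteDimensional ℝ V]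

local notation "⟪" x ", " y "⟫" => inner ℝ x y

theorem inner_modelCurv_hol {J : V →L[ℝ] V} (hJJ : ∀ v, J (J v) = -v)
    (hJ : ∀ u v, ⟪J u, v⟫ = -⟪u, J v⟫) (v : V) :
    ⟪modelCurv J v (J v) (J v), v⟫ = 4 * (⟪v, v⟫ * ⟪v, v⟫) := by
  have hJ' (u v) : ⟪J u, J v⟫ = ⟪u, v⟫ := by rw [hJ, hJJ, inner_neg_right, neg_neg]
  have : ⟪v, J v⟫ = 0 := by rw [real_inner_comm, inner_J_self hJ]
  simp only [inner_modelCurv, hJ', hJJ, inner_neg_left, inner_J_self hJ, this]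
  ring

theorem modelCurv_bianchi {J : V →L[ℝ] V} (hJ : ∀ u v, ⟪J u, v⟫ = -⟪u, J v⟫) (u v w : V) :
    modelCurv J u v w + modelCurv J v w u + modelCurv J w u v = 0 := by
  simp only [modelCurv, inner_J_swap hJ w u, inner_J_swap hJ w v,
      inner_J_swap hJ v u, real_inner_comm u v, real_inner_comm u w, real_inner_comm v w]
  module

/-- If a curvature tensor `R` agrees, up to a term `Ω(u, v) θ`, with the expression that the
tractor curvature subtracts from it, then `B` is a multiple of the metric and `R` is the
corresponding multiple of the curvature of constant holomorphic sectional curvature. -/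
theorem exists_eq_smul_modelCurv {J : V →L[ℝ] V} (hJJ : ∀ v, J (J v) = -v)
    (hJ : ∀ u v, ⟪J u, v⟫ = -⟪u, J v⟫) (hdim : 2 < Module.finrank ℝ V) {R : V → V → V → V}
    (skew : ∀ u v w, ⟪R u v w, w⟫ = 0)
    (bianchi : ∀ u v w, R u v w + R v w u + R w u v = 0)
    (B : V →L[ℝ] V →L[ℝ] ℝ) (symm : ∀ u v, B u v = B v u) (θ : V → V → ℝ)
    (hR : ∀ u v w z, ⟪z, R u v w⟫ = B v w * ⟪z, u⟫ - B u w * ⟪z, v⟫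
      - ⟪J u, w⟫ * B v (-J z) + ⟪J v, w⟫ * B u (-J z) - 2 * ⟪J u, v⟫ * θ z w) :
    ∃ a : ℝ, (∀ u v, B u v = a * ⟪u, v⟫) ∧ ∀ u v w, R u v w = a • modelCurv J u v w := by
  have hJ' (u v) : ⟪J u, J v⟫ = ⟪u, v⟫ := by rw [hJ, hJJ, inner_neg_right, neg_neg]
  -- at `v = z = w` the curvature term vanishes by skew symmetry
  obtain ⟨a, ha⟩ := eq_smul_inner_of_orthogonal hJJ hJ hdim B symm fun u w h1 h2 ↦ by
    have h3 : ⟪J u, w⟫ = 0 := by rw [hJ, h2, neg_zero]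
    have k := hR u w w w
    rw [real_inner_comm, skew, real_inner_comm, h1, h3, inner_J_self hJ] at k
    by_cases hw : w = 0
    · simp [hw]
    · have k' : B u w * ⟪w, w⟫ = 0 := by linarith
      exact (mul_eq_zero.1 k').resolve_right (inner_self_ne_zero.2 hw)
  refine ⟨a, ha, ?_⟩
  have hdiff (u v w z) : ⟪z, R u v w - a • modelCurv J u v w⟫ =
      2 * ⟪J u, v⟫ * (a * ⟪J w, z⟫ - θ z w) := by
    rw [inner_sub_right, hR, inner_smul_right, real_inner_comm (modelCurv J u v w),
      inner_modelCurv]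
    rw [ha, ha, ha, ha, inner_neg_right, inner_neg_right, hJ u z, hJ v z, real_inner_comm u z,
      real_inner_comm v z]
    ring
  -- the first Bianchi identity leaves no room for the term `Ω(u, v) θ`
  have hθ (w z) : a * ⟪J w, z⟫ - θ z w = 0 := by
    obtain ⟨u, hu, huw, huJ⟩ := exists_orthogonal_pair hdim w (J w)
    have b : (R u (J u) w - a • modelCurv J u (J u) w) + (R (J u) w u - a • modelCurv J (J u) w u)
        + (R w u (J u) - a • modelCurv J w u (J u)) = 0 := by
      have b1 := bianchi u (J u) w
      have b2 := congrArg (a • ·) (modelCurv_bianchi hJ u (J u) w)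
      simp only [smul_add, smul_zero] at b2
      rw [← sub_eq_zero_of_eq (b1.trans b2.symm)]
      abel
    have b' := congrArg (fun y ↦ ⟪z, y⟫) b
    simp only [inner_add_right, inner_zero_right, hdiff, hJJ, inner_neg_left, huw, hJ'] at b'
    rw [real_inner_comm u (J w), huJ] at b'
    have k : ⟪u, u⟫ * (a * ⟪J w, z⟫ - θ z w) = 0 := by linarith
    exact (mul_eq_zero.1 k).resolve_left (inner_self_ne_zero.2 hu)
  intro u v w
  rw [← sub_eq_zero]
  refine ext_inner_left ℝ fun z ↦ ?_
  rw [hdiff, hθ, mul_zero, inner_zero_right]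

end HermitianAlgebra

section Constant

variable {E : Type*} [NormedAddCommGroup E] [NormedSpace ℝ E]
  {M : Type*} [TopologicalSpace M] [ChartedSpace E M] [IsManifold 𝓘(ℝ, E) ∞ M]

theorem isLocallyConstant_of_mvfderiv_eq_zero {f : M → ℝ} (hf : MDifferentiable 𝓘(ℝ, E) 𝓘(ℝ, ℝ) f)
    (h0 : ∀ x, mvfderiv 𝓘(ℝ, E) f x = 0) : IsLocallyConstant f := by
  rw [IsLocallyConstant.iff_eventually_eq]
  intro x
  set φ := extChartAt 𝓘(ℝ, E) x
  have ht : IsOpen φ.target := isOpen_extChartAt_target x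
  obtain ⟨r, hr, hb⟩ := Metric.isOpen_iff.1 ht (φ x) (mem_extChartAt_target x)
  have hd (e) (he : e ∈ Metric.ball (φ x) r) : HasFDerivAt (f ∘ φ.symm) (0 : E →L[ℝ] ℝ) e := by
    have h1 : MDifferentiableAt 𝓘(ℝ, E) 𝓘(ℝ, E) φ.symm e :=
      ((contMDiffOn_extChartAt_symm (n := 1) x).contMDiffAt (ht.mem_nhds (hb he))).mdifferentiableAt
        one_ne_zero
    have h2 : mfderiv 𝓘(ℝ, E) 𝓘(ℝ, ℝ) f (φ.symm e) = 0 := by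
      ext v
      exact congrArg (fun A ↦ A v) (h0 (φ.symm e))
    have h3 := (hf (φ.symm e)).hasMFDerivAt.comp e h1.hasMFDerivAt
    rw [h2] at h3
    have h4 := h3.hasFDerivAt
    rwa [show (ContinuousLinearMap.comp (0 : TangentSpace 𝓘(ℝ, E) (φ.symm e) →L[ℝ] _)
      (mfderiv 𝓘(ℝ, E) 𝓘(ℝ, E) φ.symm e)) = 0 from ContinuousLinearMap.zero_comp _] at h4
  have hc (e) (he : e ∈ Metric.ball (φ x) r) : f (φ.symm e) = f x := by
    have := (convex_ball (φ x) r).is_const_of_fderivWithin_eq_zero (𝕜 := ℝ)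
      (fun e he ↦ (hd e he).differentiableAt.differentiableWithinAt)
      (fun e he ↦ by
        rw [fderivWithin_of_isOpen Metric.isOpen_ball he, (hd e he).fderiv])
      he (Metric.mem_ball_self hr)
    simpa [φ, extChartAt_to_inv] using this
  have hn : φ ⁻¹' Metric.ball (φ x) r ∈ 𝓝 x :=
    (continuousAt_extChartAt x).preimage_mem_nhds (Metric.ball_mem_nhds _ hr)
  filter_upwards [hn, extChartAt_source_mem_nhds (I := 𝓘(ℝ, E)) x] with y hy hys
  rw [← hc (φ y) hy, φ.left_inv hys]

end Constant

section Kahler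

variable {E : Type*} [NormedAddCommGroup E] [NormedSpace ℝ E] [FiniteDimensional ℝ E]
  {M : Type*} [TopologicalSpace M] [ChartedSpace E M] [IsManifold 𝓘(ℝ, E) ∞ M]
  [RiemannianBundle (fun x : M ↦ TangentSpace 𝓘(ℝ, E) x)]
  [IsContMDiffRiemannianBundle 𝓘(ℝ, E) ∞ E (fun x : M ↦ TangentSpace 𝓘(ℝ, E) x)]
  {cov : CovariantDerivative 𝓘(ℝ, E) E (TangentSpace 𝓘(ℝ, E) : M → Type _)}
  {J : Π x : M, TangentSpace 𝓘(ℝ, E) x →L[ℝ] TangentSpace 𝓘(ℝ, E) x}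

theorem IsKahler.sectionalCurvature_eq (hK : IsKahler cov J) {x : M}
    (v : TangentSpace 𝓘(ℝ, E) x) : sectionalCurvature cov x v (J x v) =
      inner ℝ (curvatureTensor cov x v (J x v) (J x v)) v / (inner ℝ v v * inner ℝ v v) := by
  rw [sectionalCurvature, hK.hermitian, hK.inner_self_J]
  simp

variable [T2Space M] [Nontrivial E]

/-- The pointwise consequence of symplectic flatness: the curvature has constant holomorphic
sectional curvature at each point, a priori depending on the point. -/
theorem IsKahler.exists_model_of_flat (hK : IsKahler cov J) (hdim : 2 < Module.finrank ℝ E)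
    (hflat : IsSymplecticallyFlat (kahlerForm J) (tractorConnection cov (kahlerForm J))) (x : M) :
    ∃ a : ℝ, Phi cov x = a • innerSL ℝ ∧
      ∀ u v w, curvatureTensor cov x u v w = a • modelCurv (J x) u v w := by
  obtain ⟨Θ, hΘ⟩ := hflat
  have h := hK.leviCivita
  obtain ⟨a, h1, h2⟩ := exists_eq_smul_modelCurv (V := TangentSpace 𝓘(ℝ, E) x) (J := J x)
    (hK.sq_eq_neg x) hK.inner_J_left hdim
    (fun u v w ↦ h.inner_curvatureTensor_self u v w) h.curvatureTensor_bianchi (Phi cov x)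
    (fun u v ↦ by
      change _ * ricci cov x u v = _ * ricci cov x v u
      rw [h.ricci_symm])
    (fun z w ↦ (Θ x (0, innerSL ℝ z, 0)).2.1 w) (fun u v w z ↦ by
      have e := hΘ (fieldThrough u) (fieldThrough v) (fieldThrough u).contMDiff
        (fieldThrough v).contMDiff (tractor 0 (flat (fieldThrough z)) 0) (contMDiff_tractor _ _ _) x
      have e' := (curvature_tractor_form h _ _ (fieldThrough w) _ _ x).symm.trans
        (congrArg (fun s : TractorBundle 𝓘(ℝ, E) M x ↦ s.2.1 (fieldThrough w x)) e)
      simp only [← h.curvatureTensor_eq, flat_apply, fieldThrough_self,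
        kahlerForm_apply] at e'
      -- `g(z, ·) = Ω(-J z, ·)`
      have hs : sharp (kahlerForm J) x (innerSL ℝ z) = -J x z :=
        hK.sharp_eq fun v ↦ by
          rw [map_neg, hK.sq_eq_neg, neg_neg]; rfl
      have e'' : -(inner ℝ z (curvatureTensor cov x u v w)) -
          inner ℝ (J x u) w * Phi cov x v (-J x z) + inner ℝ (J x v) w * Phi cov x u (-J x z)
          - Phi cov x u w * inner ℝ z v + Phi cov x v w * inner ℝ z u =
          2 * inner ℝ (J x u) v * (Θ x (0, innerSL ℝ z, 0)).2.1 w := by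
        rw [← hs]
        refine Eq.trans e' ?_
        have ht : tractor (0 : SmoothFn E M) (flat (fieldThrough z)) 0 x =
            (0, innerSL ℝ z, 0) := by
          rw [tractor, flat_apply, fieldThrough_self]; rfl
        rw [ht]
        rfl
      linear_combination -e'')
  refine ⟨a, ?_, h2⟩
  ext u v
  exact h1 u v

/-- Symplectic flatness of the tractor connection implies constant holomorphic sectional
curvature. -/
theorem IsKahler.hasConstantHolomorphicSectionalCurvature_of_flat [ConnectedSpace M]
    (hK : IsKahler cov J) (hdim : 2 < Module.finrank ℝ E)
    (hflat : IsSymplecticallyFlat (kahlerForm J) (tractorConnection cov (kahlerForm J))) :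
    HasConstantHolomorphicSectionalCurvature cov J := by
  choose a hΦ hR using hK.exists_model_of_flat hdim hflat
  have h := hK.leviCivita
  have hol (x : M) (v : TangentSpace 𝓘(ℝ, E) x) :
      inner ℝ (curvatureTensor cov x v (J x v) (J x v)) v =
        4 * a x * (inner ℝ v v * inner ℝ v v) := by
    rw [hR, real_inner_smul_left, inner_modelCurv_hol (hK.sq_eq_neg x) hK.inner_J_left]
    ring
  -- `a` is the quotient of the smooth functions `g(R(V, JV)JV, V)` and `4 |V|⁴`
  have smooth : ContMDiff 𝓘(ℝ, E) 𝓘(ℝ, ℝ) ∞ a := by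
    intro x
    obtain ⟨e, he⟩ := exists_ne (0 : E)
    let v : TangentSpace 𝓘(ℝ, E) x := e
    let V := fieldThrough v
    let den : SmoothFn E M := (4 : ℝ) • (ip V V * ip V V)
    have hden : den x ≠ 0 := by
      change 4 * (inner ℝ (V x) (V x) * inner ℝ (V x) (V x)) ≠ 0
      have : inner ℝ (V x) (V x) ≠ 0 := by
        rw [fieldThrough_self]
        exact inner_self_ne_zero.2 he
      positivity
    have hq := ((ip (h.curv V (hK.Jfield V) (hK.Jfield V)) V).contMDiff x).div₀
      (den.contMDiff x) hden
    refine hq.congr_of_eventuallyEq ?_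
    filter_upwards [den.contMDiff.continuous.continuousAt.eventually_ne hden] with y hy
    rw [Pi.div_apply, eq_div_iff hy, ip_apply, ← h.curvatureTensor_eq]
    change _ * (4 * (inner ℝ (V y) (V y) * inner ℝ (V y) (V y))) =
      inner ℝ (curvatureTensor cov y (V y) (J y (V y)) (J y (V y))) (V y)
    rw [hol]
    ring
  let A : SmoothFn E M := ⟨a, smooth⟩
  have hd (x : M) : mvfderiv 𝓘(ℝ, E) a x = 0 := by
    ext u
    -- for `v` orthogonal to `u` and `J u`, the tractor curvature at `(u, v)` paired with `v` is
    -- `da(u) |v|²`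
    obtain ⟨v, hv, hvu, hvJ⟩ := exists_orthogonal_pair (V := TangentSpace 𝓘(ℝ, E) x) hdim u (J x u)
    obtain ⟨Θ, hΘ⟩ := hflat
    have e := hΘ (fieldThrough u) (fieldThrough v) (fieldThrough u).contMDiff
      (fieldThrough v).contMDiff (tractor 1 0 0) (contMDiff_tractor _ _ _) x
    have e' := (curvature_tractor_one h (a := A) hΦ _ _ (fieldThrough v) _ x).symm.trans
      (congrArg (fun s : TractorBundle 𝓘(ℝ, E) M x ↦ s.2.1 (fieldThrough v x)) e)
    have hvJ' : inner ℝ (J x u) v = 0 := by rw [real_inner_comm, hvJ]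
    simp only [fieldThrough_self, kahlerForm_apply, hvJ',
      real_inner_comm v u, hvu, inner_J_self hK.inner_J_left v, mul_zero, zero_smul,
      sub_zero, add_zero] at e'
    have e'' : dir (fieldThrough u) A x * inner ℝ v v = 0 := e'
    have h0 := (mul_eq_zero.1 e'').resolve_right (inner_self_ne_zero.2 hv)
    rw [dir_apply, fieldThrough_self] at h0
    exact h0
  have hc := isLocallyConstant_of_mvfderiv_eq_zero
    (fun x ↦ (smooth x).mdifferentiableAt (by simp)) hd
  obtain ⟨x₀⟩ := (inferInstance : Nonempty M)
  refine ⟨4 * a x₀, fun x v hv ↦ ?_⟩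
  have hv' : inner ℝ v v ≠ 0 := inner_self_ne_zero.2 hv
  rw [hK.sectionalCurvature_eq, hol, hc.apply_eq_of_isPreconnected isPreconnected_univ
    (Set.mem_univ x) (Set.mem_univ x₀)]
  field_simp

end Kahler

/-! ### From constant holomorphic sectional curvature to symplectic flatness -/

section Kahler

variable {E : Type*} [NormedAddCommGroup E] [NormedSpace ℝ E] [FiniteDimensional ℝ E]
  {M : Type*} [TopologicalSpace M] [ChartedSpace E M] [IsManifold 𝓘(ℝ, E) ∞ M]
  [RiemannianBundle (fun x : M ↦ TangentSpace 𝓘(ℝ, E) x)]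
  [IsContMDiffRiemannianBundle 𝓘(ℝ, E) ∞ E (fun x : M ↦ TangentSpace 𝓘(ℝ, E) x)]
  {cov : CovariantDerivative 𝓘(ℝ, E) E (TangentSpace 𝓘(ℝ, E) : M → Type _)}
  {J : Π x : M, TangentSpace 𝓘(ℝ, E) x →L[ℝ] TangentSpace 𝓘(ℝ, E) x}

/-- If `Φ` is a constant multiple of the metric, it is parallel, and so `S = 0`. -/
theorem IsLeviCivita.S_eq_zero (h : IsLeviCivita cov) {a : ℝ}
    (ha : ∀ x, Phi cov x = a • innerSL ℝ)
    (Ω : Π x : M, TangentSpace 𝓘(ℝ, E) x →L[ℝ] TangentSpace 𝓘(ℝ, E) x →L[ℝ] ℝ) (x : M) :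
    S cov Ω x = 0 := by
  have h0 (u i j) : nablaTwoTensor cov (Phi cov) x u i j = 0 := by
    have hi := FiberBundle.mdifferentiableAt_extend 𝓘(ℝ, E) E (basisAt 𝓘(ℝ, E) x i)
    have hj := FiberBundle.mdifferentiableAt_extend 𝓘(ℝ, E) E (basisAt 𝓘(ℝ, E) x j)
    have hm := h.metric x (frameAt 𝓘(ℝ, E) x i) (frameAt 𝓘(ℝ, E) x j) hi hj u
    have hd : MDifferentiableAt 𝓘(ℝ, E) 𝓘(ℝ, ℝ)
        (fun y ↦ inner ℝ (frameAt 𝓘(ℝ, E) x i y) (frameAt 𝓘(ℝ, E) x j y)) x :=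
      MDifferentiableAt.inner_bundle (IB := 𝓘(ℝ, E)) (F := E)
        (E := fun x : M ↦ TangentSpace 𝓘(ℝ, E) x) (b := fun x ↦ x) hi hj
    have e : mvfderiv 𝓘(ℝ, E) (fun y ↦ Phi cov y (frameAt 𝓘(ℝ, E) x i y)
        (frameAt 𝓘(ℝ, E) x j y)) x u = a * mvfderiv 𝓘(ℝ, E)
          (fun y ↦ inner ℝ (frameAt 𝓘(ℝ, E) x i y) (frameAt 𝓘(ℝ, E) x j y)) x u := by
      have : (fun y ↦ Phi cov y (frameAt 𝓘(ℝ, E) x i y) (frameAt 𝓘(ℝ, E) x j y)) =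
          fun y ↦ a * inner ℝ (frameAt 𝓘(ℝ, E) x i y) (frameAt 𝓘(ℝ, E) x j y) := by
        ext y
        rw [ha]
        rfl
      rw [this, mvfderiv_fun_mul mdifferentiableAt_const hd, mvfderiv_const]
      simp
    rw [nablaTwoTensor, e, hm, ha]
    simp only [smul_apply, smul_eq_mul]
    erw [innerSL_apply_apply, innerSL_apply_apply]
    ring
  simp [S, h0]

variable [T2Space M] [Nontrivial E]

/-- If the holomorphic sectional curvature is the constant `4 a`, the curvature tensor is `a` times
the model tensor. -/
theorem IsKahler.curvatureTensor_eq_of_constant (hK : IsKahler cov J) {a : ℝ}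
    (ha : ∀ (x : M) (v : TangentSpace 𝓘(ℝ, E) x), v ≠ 0 →
      sectionalCurvature cov x v (J x v) = 4 * a) {x : M} (u v w : TangentSpace 𝓘(ℝ, E) x) :
    curvatureTensor cov x u v w = a • modelCurv (J x) u v w := by
  have h := hK.leviCivita
  refine eq_smul_modelCurv (hK.sq_eq_neg x) hK.inner_J_left h.curvatureTensor_add_left
    h.curvatureTensor_swap h.inner_curvatureTensor h.inner_curvatureTensor_pair
    h.curvatureTensor_bianchi hK.curvatureTensor_J (fun v ↦ ?_) u v w
  by_cases hv : v = 0
  · simp [hv]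
  · have := ha x v hv
    have hv' : inner ℝ v v ≠ 0 := inner_self_ne_zero.2 hv
    rwa [hK.sectionalCurvature_eq, div_eq_iff (mul_ne_zero hv' hv')] at this

/-- The tractor connection on smooth sections, if the Ricci tensor is a constant multiple of the
metric. -/
theorem IsKahler.tractorConnection_tractor (hK : IsKahler cov J) {a : ℝ} {A : SmoothFn E M}
    (hA : ∀ x, A x = a) (hΦ : ∀ x, Phi cov x = a • innerSL ℝ)
    (σ ρ : SmoothFn E M) (μ : SmoothForm E M) (Y : SmoothVF E M) :
    (fun y ↦ tractorConnection cov (kahlerForm J) (tractor σ μ ρ) y (Y y)) =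
      tractor (dir Y σ - pair μ Y)
        (hK.leviCivita.nablaForm Y μ + fsmulForm ρ (flat (hK.Jfield Y))
          + fsmulForm (A * σ) (flat Y))
        (dir Y ρ - A * pair μ (hK.Jfield Y)) := by
  funext y
  refine Prod.ext rfl (Prod.ext ?_ ?_)
  · rw [tractor_snd, hΦ]
    change hK.leviCivita.nablaForm Y μ y + ρ y • kahlerForm J y (Y y)
      + σ y • a • innerSL ℝ (Y y) = hK.leviCivita.nablaForm Y μ y + ρ y • kahlerForm J y (Y y)
        + (A y * σ y) • innerSL ℝ (Y y)
    rw [hA, smul_smul, mul_comm]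
  · rw [tractor_trd, hΦ, hK.leviCivita.S_eq_zero hΦ]
    change _ - a * inner ℝ (Y y) (sharp (kahlerForm J) y (μ y)) + _ * 0 =
      _ - A y * μ y (J y (Y y))
    rw [mul_zero, add_zero, hK.inner_sharp, hA]
    rfl

/-- Constant holomorphic sectional curvature implies that the tractor connection is symplectically
flat, with `Θ (σ, μ, ρ) = (ρ, a μ ∘ J, -a² σ)`, where the holomorphic sectional curvature
is `4 a`. -/
theorem IsKahler.flat_of_hasConstantHolomorphicSectionalCurvature (hK : IsKahler cov J)
    (hc : HasConstantHolomorphicSectionalCurvature cov J) :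
    IsSymplecticallyFlat (kahlerForm J) (tractorConnection cov (kahlerForm J)) := by
  obtain ⟨c, hc⟩ := hc
  obtain ⟨a, rfl⟩ : ∃ a, c = 4 * a := ⟨c / 4, by ring⟩
  have hR {x : M} := hK.curvatureTensor_eq_of_constant hc (x := x)
  have hΦ (x : M) := hK.Phi_eq_of_model (hR (x := x))
  have h := hK.leviCivita
  let A : SmoothFn E M := ⟨fun _ ↦ a, contMDiff_const⟩
  have hdA (X : SmoothVF E M) : dir X A = 0 := by
    ext x
    exact mvfderiv_zero_apply x (X x) a
  refine ⟨fun x ↦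
    { toFun := fun s ↦ (s.2.2, a • (s.2.1.comp (J x)), -(a * a * s.1))
      map_add' := fun s t ↦ by
        refine Prod.ext rfl (Prod.ext ?_ ?_)
        · exact (congrArg (a • ·) (ContinuousLinearMap.add_comp _ _ _)).trans (smul_add _ _ _)
        · change -(a * a * (s.1 + t.1)) = -(a * a * s.1) + -(a * a * t.1)
          ring
      map_smul' := fun r s ↦ by
        refine Prod.ext rfl (Prod.ext ?_ ?_)
        · exact (congrArg (a • ·) (ContinuousLinearMap.smul_comp _ _ _)).trans (smul_comm _ _ _)
        · change -(a * a * (r * s.1)) = r * -(a * a * s.1)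
          ring }, ?_⟩
  intro X Y hX hY s hs x
  obtain ⟨σ, μ, ρ, rfl⟩ := exists_tractor_eq hs
  -- with `2 Ω(X, Y)` written as a sum, each component on the right is by definition the value at
  -- `x` of an expression in smooth functions
  suffices H : ∀ X Y : SmoothVF E M, curvature (tractorConnection cov (kahlerForm J)) X Y
      (tractor σ μ ρ) x = (((ip (hK.Jfield X) Y x + ip (hK.Jfield X) Y x) * ρ x,
        (ip (hK.Jfield X) Y x + ip (hK.Jfield X) Y x) • a • (μ x).comp (J x),
        (ip (hK.Jfield X) Y x + ip (hK.Jfield X) Y x) * -(a * a * σ x)) :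
          TractorBundle 𝓘(ℝ, E) M x) by
    refine (H ⟨X, hX⟩ ⟨Y, hY⟩).trans ?_
    rw [← two_mul]
    rfl
  clear hX hY X Y
  intro X Y
  have hD := hK.tractorConnection_tractor (A := A) (fun _ ↦ rfl) hΦ
  have hcurv : curvature (tractorConnection cov (kahlerForm J)) X Y (tractor σ μ ρ) x =
      (fun y ↦ tractorConnection cov (kahlerForm J) (fun z ↦ tractorConnection cov (kahlerForm J)
        (tractor σ μ ρ) z (Y z)) y (X y)) x
      - (fun y ↦ tractorConnection cov (kahlerForm J) (fun z ↦ tractorConnection cov (kahlerForm J)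
        (tractor σ μ ρ) z (X z)) y (Y y)) x
      - (fun y ↦ tractorConnection cov (kahlerForm J) (tractor σ μ ρ) y (lie X Y y)) x := rfl
  have hsub (σ σ' ρ ρ' : SmoothFn E M) (μ μ' : SmoothForm E M) :
      tractor σ μ ρ x - tractor σ' μ' ρ' x = tractor (σ - σ') (μ - μ') (ρ - ρ') x := rfl
  -- the three components become identities between smooth functions, evaluated at `x`
  rw [hcurv, hD, hD, hD, hD, hD, hsub, hsub]
  have s0 : ip Y X = ip X Y := ip_comm Y X
  have s1 : ip (hK.Jfield Y) X = -ip (hK.Jfield X) Y := by rw [hK.ip_Jfield_left, ip_comm]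
  have s2 : ip (hK.Jfield Y) (hK.Jfield X) = ip (hK.Jfield X) (hK.Jfield Y) := ip_comm _ _
  have s3 : ip X (hK.Jfield Y) = -ip (hK.Jfield X) Y := by rw [hK.ip_Jfield_left, neg_neg]
  have s4 : ip Y (hK.Jfield X) = ip (hK.Jfield X) Y := ip_comm _ _
  have hsubF (μ ν : SmoothForm E M) (X : SmoothVF E M) :
      pair (μ - ν) X = pair μ X - pair ν X := rfl
  have hl (Z : SmoothVF E M) : ip (lie X Y) Z = ip (h.nabla X Y) Z - ip (h.nabla Y X) Z := by
    rw [← h.nabla_sub_nabla, ip_sub_left]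
  have hlJ (Z : SmoothVF E M) : ip (hK.Jfield (lie X Y)) Z =
      ip (hK.Jfield (h.nabla X Y)) Z - ip (hK.Jfield (h.nabla Y X)) Z := by
    rw [← h.nabla_sub_nabla, hK.Jfield_sub, ip_sub_left]
  have hlp : pair μ (lie X Y) = pair μ (h.nabla X Y) - pair μ (h.nabla Y X) := by
    rw [← h.nabla_sub_nabla, pair_sub]
  have hlpJ : pair μ (hK.Jfield (lie X Y)) =
      pair μ (hK.Jfield (h.nabla X Y)) - pair μ (hK.Jfield (h.nabla Y X)) := by
    rw [← h.nabla_sub_nabla, hK.Jfield_sub, pair_sub]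
  refine Prod.ext ?_ (Prod.ext ?_ ?_)
  · refine congrArg (fun f : SmoothFn E M ↦ f x)
      (?_ : _ = (ip (hK.Jfield X) Y + ip (hK.Jfield X) Y) * ρ)
    simp only [dir_sub, pair_add_left, pair_fsmulForm, pair_flat, h.pair_nablaForm, dir_lie,
        hlp, s0, s1]
    ring
  · ext v
    obtain ⟨Z, rfl⟩ : ∃ Z : SmoothVF E M, Z x = v := ⟨fieldThrough v, fieldThrough_self v⟩
    have hcv : pair μ (h.curv X Y Z) = A * (ip Y Z * pair μ X
        - ip X Z * pair μ Y + ip (hK.Jfield Y) Z * pair μ (hK.Jfield X)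
        - ip (hK.Jfield X) Z * pair μ (hK.Jfield Y)
        - (ip (hK.Jfield X) Y + ip (hK.Jfield X) Y) * pair μ (hK.Jfield Z)) := by
      ext y
      rw [pair_apply, ← h.curvatureTensor_eq, hR]
      refine (map_smul (μ y) _ _).trans (congrArg (a * ·) ?_)
      rw [modelCurv, two_mul]
      refine (map_sub (μ y) _ _).trans ?_
      simp only [map_sub, map_add, map_smul]
      rfl
    refine congrArg (fun f : SmoothFn E M ↦ f x) (?_ : pair _ Z =
      (ip (hK.Jfield X) Y + ip (hK.Jfield X) Y) * (A * pair μ (hK.Jfield Z)))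
    have hc := h.nablaForm_curv X Y Z μ
    rw [hcv] at hc
    simp only [hsubF, pair_add_left, pair_fsmulForm, pair_flat, h.pair_nablaForm, dir_lie, dir_add,
      dir_sub, dir_mul, hdA, h.dir_ip, hK.nabla_Jfield, hl, hlJ] at hc ⊢
    linear_combination hc
  · refine congrArg (fun f : SmoothFn E M ↦ f x)
      (?_ : _ = (ip (hK.Jfield X) Y + ip (hK.Jfield X) Y) * -(A * A * σ))
    simp only [dir_sub, dir_mul, hdA, pair_add_left, pair_fsmulForm, pair_flat, h.pair_nablaForm,
      dir_lie, hlpJ, hK.nabla_Jfield, s2, s3, s4]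
    ring

end Kahler

end SymplecticTractor

end

theorem mainTheorem4
    {E : Type*} [NormedAddCommGroup E] [NormedSpace ℝ E] [FiniteDimensional ℝ E]
    {n : ℕ} (hn : 2 ≤ n) (hdim : Module.finrank ℝ E = 2 * n)
    {M : Type*} [TopologicalSpace M] [T2Space M] [SecondCountableTopology M] [ConnectedSpace M]
    [ChartedSpace E M] [IsManifold 𝓘(ℝ, E) ∞ M]
    [RiemannianBundle (fun x : M ↦ TangentSpace 𝓘(ℝ, E) x)]
    [IsContMDiffRiemannianBundle 𝓘(ℝ, E) ∞ E (fun x : M ↦ TangentSpace 𝓘(ℝ, E) x)]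
    (cov : CovariantDerivative 𝓘(ℝ, E) E (TangentSpace 𝓘(ℝ, E) : M → Type _))
    (J : Π x : M, TangentSpace 𝓘(ℝ, E) x →L[ℝ] TangentSpace 𝓘(ℝ, E) x)
    (hK : SymplecticTractor.IsKahler cov J) :
    SymplecticTractor.IsSymplecticallyFlat (SymplecticTractor.kahlerForm J)
        (SymplecticTractor.tractorConnection cov (SymplecticTractor.kahlerForm J)) ↔
      SymplecticTractor.HasConstantHolomorphicSectionalCurvature cov J := by
  have hpos : 2 < Module.finrank ℝ E := by omega
  have : Nontrivial E := Module.nontrivial_of_finrank_pos (R := ℝ) (by omega)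
  exact ⟨hK.hasConstantHolomorphicSectionalCurvature_of_flat hpos,
    hK.flat_of_hasConstantHolomorphicSectionalCurvature⟩
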